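/- **Frobenius potentials.** For $N\ge 1$ let $\Lambda=\frac{x^{N+1}}{N+1}+y^2+\sum_{k=1}^N v_kx^{k-1}$ be the unfolding of the $A_N$ singularity. The ring $\mathbb C[x,y]/(\partial_x\Lambda,\partial_y\Lambda)$ has the basis $\partial\Lambda/\partial v_k=x^{k-1}$, $1\le k\le N$; identifying $\partial/\partial v_k$ with $\partial\Lambda/\partial v_k$, one gets a product $\circ$ on vector fields in $v$ and the pairing $\eta$, where $\eta(a,b)$ is the coefficient of $x^{N-1}$ in $a\circ b$. Let $t_1,\dots,t_N$ be the flat coordinates, with $v_k\in\mathbb C[t_1,\dots,t_N]$ normalized by $v_k=t_k+(\text{terms of order}\ge 2)$ and $\eta(\partial/\partial t_\alpha,\partial/\partial t_\beta)=\delta_{\alpha+\beta,N+1}$, and let $F_{A_N}\in\mathbb C[t_1,\dots,t_N]$ be the (unique) polynomial with $$\frac{\partial}{\partial t_\alpha}\circ\frac{\partial}{\partial t_\beta}=\sum_{\gamma=1}^N\frac{\partial^3F_{A_N}}{\partial t_\alpha\partial t_\beta\partial t_\gamma}\frac{\partial}{\partial t_{N+1-\gamma}},\qquad \sum_{\alpha=1}^N\frac{N+2-\alpha}{N+1}\,t_\alpha\frac{\partial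 F_{A_N}}{\partial t_\alpha}=\Bigl(3-\frac{N-1}{N+1}\Bigr)F_{A_N}.$$ Put $F_{B_N}(t_1,\dots,t_N)=F_{A_{2N-1}}(t_1,0,t_2,0,\dots,0,t_N)$. **Hierarchy of type $B$.** For $\alpha,\beta,m,\gamma_1,\dots,\gamma_m\ge 1$ with $\gamma_1+\dots+\gamma_m=\alpha+\beta-1$ put, with $N=\alpha+\beta+1$, $$R^{\mathrm B}_{\alpha,\beta;\gamma_1,\dots,\gamma_m}=\frac1{m!}\left.\frac{\partial^{m+2}F_{B_N}}{\partial t_\alpha\,\partial t_\beta\,\partial t_{N+1-\gamma_1}\cdots\partial t_{N+1-\gamma_m}}\right|_{t=0},$$ and consider the system of PDEs on $f=f(t_1,t_2,t_3,\dots)$ $$\partial_\alpha\partial_\beta f=\sum_{m\ge1}\ \sum_{\gamma_1+\dots+\gamma_m=\alpha+\beta-1}R^{\mathrm B}_{\alpha,\beta;\gamma_1,\dots,\gamma_m}\,\partial_1\partial_{\gamma_1}f\cdots\partial_1\partial_{\gamma_m}f\qquad(\alpha,\beta\ge1).\tag{B}$$ **Dispersionless BKP hierarchy.** For $F_0=F_0(t_1,t_3,t_5,\dots)$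 and $D^{\mathrm B}(z)=\sum_{n\ge0}\frac{z^{-2n-1}}{2n+1}\partial_{2n+1}$ it is the following identity of formal series in $z_1^{-1},z_2^{-1}$: $$\left(1-\frac{\partial_1(2D^{\mathrm B}(z_1)+2D^{\mathrm B}(z_2))F_0}{z_1+z_2}\right)e^{2D^{\mathrm B}(z_1)\cdot 2D^{\mathrm B}(z_2)F_0}=1-\frac{\partial_1(2D^{\mathrm B}(z_1)-2D^{\mathrm B}(z_2))F_0}{z_1-z_2}.\tag{BKP-dl}$$ **Theorem.** The system (B) coincides with the dispersionless BKP hierarchy (BKP-dl) after the change of variables $t_k\mapsto t_{2k-1}/(2k-1)$ and the substitution $f\mapsto 2F_0$. That is, a formal power series $F_0(t_1,t_3,t_5,\dots)$ over $\mathbb C$ satisfies (BKP-dl) if and only if the series $f(t_1,t_2,t_3,\dots)=2F_0\bigl(t_1,\tfrac{t_2}{3},\tfrac{t_3}{5},\dots\bigr)$, obtained from $2F_0$ by replacing every $t_{2k-1}$ by $t_k/(2k-1)$, satisfies (B). -/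

import Mathlib

/-!
All variables are numbered from `0` where a type of variables is concerned: in the polynomial ring
over `Fin N` the variable `i` is `t_{i+1}` (or `v_{i+1}`), in the ring of power series in which `f`
lives the variable `n : ℕ` is `t_{n+1}`, and in the ring in which `F₀` lives (only odd times) the
variable `n : ℕ` is `t_{2n+1}`.
-/

noncomputable section

namespace Frob

/-! ### The Frobenius manifold of the `A_N` singularity -/

/-- The polynomial ring `ℂ[t_1, …, t_N]`. -/
abbrev Poly (N : ℕ) : Type := MvPolynomial (Fin N) ℂ

/-- The unfolding `Λ = x^{N+1}/(N+1) + ∑_k v_k x^{k-1}` of the `A_N` singularity, as a polynomial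
in `x`, where the unfolding parameters `v_k` are polynomials in coordinates `t_1, …, t_N`.
(The square `y²` is omitted: its partial derivative `2y` eliminates `y` from the Jacobian ring.) -/
def unfolding (N : ℕ) (v : Fin N → Poly N) : Polynomial (Poly N) :=
  Polynomial.C (MvPolynomial.C (1 / ((N : ℂ) + 1))) * Polynomial.X ^ (N + 1)
    + ∑ k : Fin N, Polynomial.C (v k) * Polynomial.X ^ (k : ℕ)

/-- The polynomial `∂Λ/∂x`, which generates the Jacobian ideal. -/
def unfoldingDeriv (N : ℕ) (v : Fin N → Poly N) : Polynomial (Poly N) :=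
  Polynomial.derivative (unfolding N v)

/-- `∂Λ/∂x` is monic of degree `N`, so that division with remainder by it makes sense and
`1, x, …, x^{N-1}` is a basis of the Jacobian ring. -/
theorem unfoldingDeriv_monic (N : ℕ) (v : Fin N → Poly N) :
    (unfoldingDeriv N v).Monic ∧ (unfoldingDeriv N v).natDegree = N := by
  have h0 : unfoldingDeriv N v = Polynomial.X ^ N
      + ∑ k : Fin N, Polynomial.derivative (Polynomial.C (v k) * Polynomial.X ^ (k : ℕ)) := by
    have hN : (N : ℂ) + 1 ≠ 0 := by exact_mod_cast Nat.succ_ne_zero N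
    have h1 : (MvPolynomial.C (1 / ((N : ℂ) + 1)) : Poly N) * ((N : Poly N) + 1) = 1 := by
      rw [← map_natCast (MvPolynomial.C (R := ℂ) (σ := Fin N)) N, ← map_one MvPolynomial.C,
        ← map_add, ← map_mul]
      congr 1
      field_simp
    simp only [unfoldingDeriv, unfolding, map_add, map_sum, Polynomial.derivative_C_mul,
      Polynomial.derivative_X_pow, Nat.add_sub_cancel]
    rw [← mul_assoc, ← Polynomial.C_mul, Nat.cast_add, Nat.cast_one, h1]
    simp
  have hlt : (∑ k : Fin N, Polynomial.derivative
      (Polynomial.C (v k) * Polynomial.X ^ (k : ℕ))).degree < (N : WithBot ℕ) := by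
    refine lt_of_le_of_lt (Polynomial.degree_sum_le _ _)
      ((Finset.sup_lt_iff (WithBot.bot_lt_coe N)).2 ?_)
    intro k _
    refine lt_of_le_of_lt (Polynomial.degree_derivative_le) ?_
    refine lt_of_le_of_lt (Polynomial.degree_C_mul_X_pow_le _ _) ?_
    exact WithBot.coe_lt_coe.2 k.2
  rw [h0]
  exact ⟨Polynomial.monic_X_pow_add hlt,
    by rw [Polynomial.natDegree_add_eq_left_of_degree_lt (by simpa using hlt),
      Polynomial.natDegree_X_pow]⟩

/-- `∂Λ/∂t_α = ∑_k (∂v_k/∂t_α) x^{k-1}`: the element of the Jacobian ring that represents the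
vector field `∂/∂t_α`. -/
def tangent (N : ℕ) (v : Fin N → Poly N) (α : Fin N) : Polynomial (Poly N) :=
  ∑ k : Fin N, Polynomial.C (MvPolynomial.pderiv α (v k)) * Polynomial.X ^ (k : ℕ)

/-- The product of two elements of the Jacobian ring, as a combination of the basis elements
`∂Λ/∂v_k = x^{k-1}`, `1 ≤ k ≤ N`. -/
def circ (N : ℕ) (v : Fin N → Poly N) (a b : Polynomial (Poly N)) : Polynomial (Poly N) :=
  (a * b) %ₘ unfoldingDeriv N v

/-- The residue pairing: the coefficient of `∂Λ/∂v_N = x^{N-1}` in the product. -/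
def eta (N : ℕ) (v : Fin N → Poly N) (a b : Polynomial (Poly N)) : Poly N :=
  (circ N v a b).coeff (N - 1)

/-- `v = v(t)` expresses the unfolding parameters through flat coordinates `t`, normalized by
`v_k = t_k + (terms of order at least two)` and by `η(∂/∂t_α, ∂/∂t_β) = δ_{α+β,N+1}`. -/
structure IsFlat (N : ℕ) (v : Fin N → Poly N) : Prop where
  constantCoeff_eq : ∀ k, MvPolynomial.constantCoeff (v k) = 0
  linear_eq : ∀ k α, MvPolynomial.coeff (Finsupp.single α 1) (v k) = if α = k then 1 else 0
  eta_eq : ∀ α β, eta N v (tangent N v α) (tangent N v β) = if β = α.rev then 1 else 0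

/-- `F` is the potential of the `A_N` Frobenius manifold in the normalized flat coordinates:
`∂/∂t_α ∘ ∂/∂t_β = ∑_{γ,δ} (∂³F/∂t_α∂t_β∂t_γ) η^{γδ} ∂/∂t_δ`, and `E·F = (3 - δ) F` for
`E = ∑_α (N+2-α)/(N+1) t_α ∂/∂t_α` and `δ = (N-1)/(N+1)`. -/
def IsPotentialA (N : ℕ) (F : Poly N) : Prop :=
  (∃ v : Fin N → Poly N, IsFlat N v ∧
    ∀ α β, circ N v (tangent N v α) (tangent N v β) =
      ∑ γ : Fin N, Polynomial.C (MvPolynomial.pderiv α (MvPolynomial.pderiv β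
        (MvPolynomial.pderiv γ F))) * tangent N v γ.rev) ∧
  ∑ α : Fin N, MvPolynomial.C (((N : ℂ) + 1 - (α : ℕ)) / ((N : ℂ) + 1)) *
      (MvPolynomial.X α * MvPolynomial.pderiv α F) =
    MvPolynomial.C (3 - ((N : ℂ) - 1) / ((N : ℂ) + 1)) * F

open Classical in
/-- The potential `F_{A_N}`: the unique polynomial with the property `IsPotentialA N`. -/
def FA (N : ℕ) : Poly N :=
  if h : ∃! F : Poly N, IsPotentialA N F then h.choose else 0

/-- `F_{B_N}(t_1, …, t_N) = F_{A_{2N-1}}(t_1, 0, t_2, 0, …, 0, t_N)`. -/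
def FB (N : ℕ) : Poly N :=
  MvPolynomial.aeval (fun j : Fin (2 * N - 1) =>
    if (j : ℕ) % 2 = 0 then (MvPolynomial.X ⟨(j : ℕ) / 2, by omega⟩ : Poly N) else 0)
    (FA (2 * N - 1))

/-! ### The hierarchy of type `B` -/

/-- `∂/∂t_a` on `ℂ[t_1, …, t_N]` for `1 ≤ a ≤ N`. -/
def dPoly (N a : ℕ) (P : Poly N) : Poly N :=
  if h : 1 ≤ a ∧ a ≤ N then MvPolynomial.pderiv (⟨a - 1, by omega⟩ : Fin N) P else 0

/-- `R^{(B_N)}_{α,β;γ_1,…,γ_m} = (1/m!) ∂^{m+2}F_{B_N} / ∂t_α ∂t_β ∂t_{N+1-γ_1} ⋯ ∂t_{N+1-γ_m}`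
at `t = 0`. -/
def RBN (N α β : ℕ) (γ : List ℕ) : ℂ :=
  1 / (γ.length.factorial : ℂ) * MvPolynomial.constantCoeff
    (γ.foldr (fun g P => dPoly N (N + 1 - g) P) (dPoly N α (dPoly N β (FB N))))

/-- `R^B_{α,β;γ_1,…,γ_m} = R^{(B_{α+β+1})}_{α,β;γ_1,…,γ_m}`. -/
def RB (α β : ℕ) (γ : List ℕ) : ℂ := RBN (α + β + 1) α β γ

/-- Formal power series over `ℂ` in infinitely many times. -/
abbrev TSeries : Type := MvPowerSeries ℕ ℂ

/-- `∂_k = ∂/∂t_k`, `k ≥ 1`, on power series in `t_1, t_2, t_3, …`. -/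
def dT (k : ℕ) (f : TSeries) : TSeries := MvPowerSeries.pderiv ℂ (k - 1) f

/-- The system
`∂_α ∂_β f = ∑_{m ≥ 1} ∑_{γ_1+…+γ_m = α+β-1} R^B_{α,β;γ_1,…,γ_m} ∂_1∂_{γ_1} f ⋯ ∂_1∂_{γ_m} f`
for all `α, β ≥ 1`. The sum runs over the compositions of `α+β-1`, that is, over
the finite sequences of positive integers with this sum. -/
def SolvesBHierarchy (f : TSeries) : Prop :=
  ∀ α β : ℕ, 1 ≤ α → 1 ≤ β →
    dT α (dT β f) = ∑ γ : Composition (α + β - 1),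
      RB α β γ.blocks • (γ.blocks.map fun g => dT 1 (dT g f)).prod

/-! ### The dispersionless BKP hierarchy -/

/-- `∂_{2n+1} = ∂/∂t_{2n+1}` on power series in the odd times `t_1, t_3, t_5, …`. -/
def dOdd (n : ℕ) (F : TSeries) : TSeries := MvPowerSeries.pderiv ℂ n F

/-- Power series in `z_1^{-1}` (variable `0`) and `z_2^{-1}` (variable `1`) whose coefficients are
power series in the times. -/
abbrev ZSeries : Type := MvPowerSeries (Fin 2) TSeries

/-- `∂_1` acting on the coefficients of a series in `z_1^{-1}, z_2^{-1}`. -/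
def dFirst (G : ZSeries) : ZSeries := fun d => dOdd 0 (MvPowerSeries.coeff d G)

/-- The operator `D^B(z) = ∑_{n ≥ 0} z^{-2n-1}/(2n+1) ∂_{2n+1}` for `z = z_1` (`i = 0`) or `z = z_2`
(`i = 1`), through the coefficients of the resulting series. -/
def DB (i : Fin 2) (G : ZSeries) : ZSeries := fun d =>
  ∑ n ∈ Finset.range (d i), if 2 * n + 1 ≤ d i then
    (1 / (2 * (n : ℂ) + 1)) •
      dOdd n (MvPowerSeries.coeff (d - Finsupp.single i (2 * n + 1)) G) else 0

/-- The exponential of a series without constant term. -/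
def expZ (G : ZSeries) : ZSeries := (PowerSeries.exp ℂ).subst G

/-- The field of fractions of the domain of power series in `z_1^{-1}, z_2^{-1}`. -/
abbrev ZField : Type := FractionRing ZSeries

/-- A power series as an element of the field of fractions. -/
def toF (G : ZSeries) : ZField := algebraMap ZSeries ZField G

/-- `z_1` (`i = 0`) and `z_2` (`i = 1`). -/
def z (i : Fin 2) : ZField := (toF (MvPowerSeries.X i))⁻¹

/-- The dispersionless BKP hierarchy
`(1 - ∂_1(2D(z_1)+2D(z_2))F₀/(z_1+z_2)) exp(2D(z_1)·2D(z_2)F₀) = 1 - ∂_1(2D(z_1)-2D(z_2))F₀/(z_1-z_2)`,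
`D = D^B`. -/
def SolvesDispersionlessBKP (F₀ : TSeries) : Prop :=
  let G : ZSeries := MvPowerSeries.C F₀
  (1 - toF (dFirst (2 * DB 0 G + 2 * DB 1 G)) / (z 0 + z 1)) *
      toF (expZ (2 * DB 0 (2 * DB 1 G))) =
    1 - toF (dFirst (2 * DB 0 G - 2 * DB 1 G)) / (z 0 - z 1)

/-- `f(t_1, t_2, t_3, …) = 2 F₀(t_1, t_2/3, t_3/5, …)`: the time `t_{2k-1}` of `F₀` is replaced
by `t_k/(2k-1)`, and the result is multiplied by two. -/
def changeOfVariables (F₀ : TSeries) : TSeries :=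
  2 * MvPowerSeries.rescale (fun n : ℕ => 1 / (2 * (n : ℂ) + 1)) F₀

end Frob

end

/-!
In flat coordinates, put `s_g = t_{N-g}`. The polynomials `Q_n` with generating function
`∑ Q_n w^n = 1 / (1 - x w - ∑ s_g w^{g+2})` are `∂Λ/∂t_{n+1}` for `n < N` and `∂Λ/∂x` for `n = N`,
and `∂Q_a/∂t_{d+1}` is the `x`-derivative of `Q_{a+d-N}`, hence symmetric in `a` and `d`. The
residue pairing of `Q_a` and `Q_b` is constant, and the residues of `Q_a Q_b Q_c` form a closed
homogeneous tensor, whose potential is `F_{A_N}`. By homogeneity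
`(a + b + 2) ∂_{a+1} ∂_{b+1} F_{A_N}` is the pairing of `Q_a Q_b` with the Euler field, and the
recursion of the `Q_n` gives a recursion in `a` and `b` for it, in which `N` plays no role.

The same recursion holds for the coefficients at `w₀^{a+1} w₁^{b+1}` of `L`, the logarithmic
derivative of `A = 1 + ∑ s_{p+q} w₀^{p+1} w₁^{q+1}` along the Euler field
`θ = w₀ ∂/∂w₀ + w₁ ∂/∂w₁`, because `(w₁ - w₀) A` is `w₁ - w₀` minus `w₀ w₁` times a difference of
series in one variable. So (B) expresses each `∂_α ∂_β f` through `L`, evaluated where `s_g` is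
`∂_1 ∂_{g/2+1} f` for even `g` and `0` for odd `g`.

With `w_i = z_{i+1}⁻¹`, (BKP-dl) reads `A(w₀, -w₁) exp Φ = A(w₀, w₁)` at the same point, where `Φ`
is the generating series of the second derivatives of `F₀`. As `θ` only kills constants, this says
`θ Φ = L(w₀, w₁) - L(w₀, -w₁)`, whose coefficients are the equations (B) again.
-/

noncomputable section

namespace Frob

/-! ### Derivations acting on the coefficients of polynomials -/

section CoeffDerivation

open Polynomial

variable {R A : Type*} [CommRing R] [CommRing A] [Algebra R A]

/-- The derivation of `A[X]` that kills `X` and extends a derivation of `A`. -/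
def coeffDerivation (d : Derivation R A A) : Derivation R A[X] A[X] :=
  PolynomialModule.equivPolynomialSelf.toLinearMap.compDer d.mapCoeffs

@[simp]
theorem coeff_coeffDerivation (d : Derivation R A A) (p : A[X]) (n : ℕ) :
    (coeffDerivation d p).coeff n = d (p.coeff n) := rfl

@[simp]
theorem coeffDerivation_C (d : Derivation R A A) (a : A) :
    coeffDerivation d (C a) = C (d a) := by
  ext n
  rw [coeff_coeffDerivation, coeff_C, coeff_C, apply_ite d, map_zero]

@[simp]
theorem coeffDerivation_X (d : Derivation R A A) : coeffDerivation d X = 0 := by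
  ext n
  rw [coeff_coeffDerivation, coeff_X, apply_ite d, map_zero, Derivation.map_one_eq_zero, ite_self,
    coeff_zero]

theorem coeffDerivation_C_mul (d : Derivation R A A) (a : A) (p : A[X]) :
    coeffDerivation d (C a * p) = C (d a) * p + C a * coeffDerivation d p := by
  rw [Derivation.leibniz, coeffDerivation_C, smul_eq_mul, smul_eq_mul, add_comm, mul_comm p]

theorem coeffDerivation_derivative (d : Derivation R A A) (p : A[X]) :
    coeffDerivation d (derivative p) = derivative (coeffDerivation d p) := by
  ext n
  simp [coeff_derivative, mul_comm]

theorem coeffDerivation_comm {d e : Derivation R A A} (h : ∀ a, d (e a) = e (d a)) (p : A[X]) :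
    coeffDerivation d (coeffDerivation e p) = coeffDerivation e (coeffDerivation d p) := by
  ext n
  simp only [coeff_coeffDerivation, h]

theorem degree_coeffDerivation_lt (d : Derivation R A A) {p : A[X]} {n : ℕ} (hp : p.degree < n) :
    (coeffDerivation d p).degree < n := by
  rw [degree_lt_iff_coeff_zero] at hp ⊢
  intro m hm
  rw [coeff_coeffDerivation, hp m hm, map_zero]

end CoeffDerivation

/-! ### The polynomials `Q_n` -/

section FlatPoly

open Polynomial Finset

variable {A : Type*} [CommRing A]

/-- The polynomials `Q_n` with generating function
`∑ Q_n w^n = 1 / (1 - x w - ∑ s_g w^{g+2})`. For a suitable numbering `s` of the flat coordinates,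
`Q_n` is `∂Λ/∂t_{n+1}` if `n < N`, and `Q_N` is `∂Λ/∂x`. -/
def flatPoly (s : ℕ → A) : ℕ → A[X]
  | 0 => 1
  | n + 1 => X * flatPoly s n + ∑ g : Fin n, C (s g) * flatPoly s (n - (g + 1))

@[simp]
theorem flatPoly_zero (s : ℕ → A) : flatPoly s 0 = 1 := by rw [flatPoly]

theorem flatPoly_succ (s : ℕ → A) (n : ℕ) : flatPoly s (n + 1) =
    X * flatPoly s n + ∑ g ∈ range n, C (s g) * flatPoly s (n - (g + 1)) := by
  rw [flatPoly, sum_range fun g => C (s g) * flatPoly s (n - (g + 1))]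

theorem map_flatPoly {B : Type*} [CommRing B] (φ : A →+* B) (s : ℕ → A) (n : ℕ) :
    (flatPoly s n).map φ = flatPoly (fun g => φ (s g)) n := by
  induction n using Nat.strong_induction_on with
  | _ n ih =>
    cases n with
    | zero => simp
    | succ n =>
      rw [flatPoly_succ, flatPoly_succ, Polynomial.map_add, Polynomial.map_mul, map_X,
        ih n (by omega), Polynomial.map_sum]
      refine congrArg _ (sum_congr rfl fun g _ => ?_)
      rw [Polynomial.map_mul, map_C, ih _ (by omega)]

theorem flatPoly_of_eq_zero {s : ℕ → A} (hs : ∀ g, s g = 0) (n : ℕ) : flatPoly s n = X ^ n := by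
  induction n with
  | zero => simp
  | succ n ih => simp [flatPoly_succ, hs, ih, pow_succ']

theorem coeffDerivation_flatPoly {R : Type*} [CommRing R] [Algebra R A] (d : Derivation R A A)
    {s : ℕ → A} {j : ℕ} (hd : ∀ g, d (s g) = if g = j then 1 else 0) (n : ℕ) :
    coeffDerivation d (flatPoly s n) = derivative (flatPoly s (n - (j + 1))) := by
  induction n using Nat.strong_induction_on with
  | _ n ih =>
    cases n with
    | zero => simp
    | succ n =>
      have hterm : ∀ g ∈ range n, coeffDerivation d (C (s g) * flatPoly s (n - (g + 1))) =
          (if g = j then flatPoly s (n - (j + 1)) else 0) +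
            C (s g) * derivative (flatPoly s (n - (j + 1) - (g + 1))) := by
        intro g _
        rw [coeffDerivation_C_mul, hd, ih _ (by omega), Nat.sub_right_comm]
        split_ifs with h <;> simp [h]
      rw [flatPoly_succ, map_add, Derivation.leibniz, coeffDerivation_X, smul_zero, add_zero,
        smul_eq_mul, ih n (by omega), map_sum, sum_congr rfl hterm, sum_add_distrib, sum_ite_eq']
      rcases lt_or_ge j n with hj | hj
      · obtain ⟨m, rfl⟩ : ∃ m, n = j + 1 + m := ⟨n - (j + 1), by omega⟩
        have hsum : ∑ g ∈ range (j + 1 + m), C (s g) * derivative (flatPoly s (m - (g + 1))) =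
            ∑ g ∈ range m, C (s g) * derivative (flatPoly s (m - (g + 1))) := by
          refine (sum_subset (range_mono (by omega)) fun g _ hg => ?_).symm
          rw [show m - (g + 1) = 0 by grind, flatPoly_zero, derivative_one, mul_zero]
        rw [if_pos (mem_range.2 hj), show j + 1 + m + 1 - (j + 1) = m + 1 by omega,
          Nat.add_sub_cancel_left, hsum, flatPoly_succ, derivative_add, derivative_mul,
          derivative_X, derivative_sum]
        simp only [derivative_C_mul]
        ring
      · rw [if_neg (by simpa using hj), show n - (j + 1) = 0 by omega,
          show n + 1 - (j + 1) = 0 by omega]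
        simp

/-- The extension of a derivation of `A` to `A[X]` that makes `X` homogeneous of weight one. -/
def eulerDerivation {R : Type*} [CommRing R] [Algebra R A] (E : Derivation R A A) :
    Derivation R A[X] A[X] :=
  coeffDerivation E + (X : A[X]) • (derivative' (R := A)).restrictScalars R

theorem eulerDerivation_apply {R : Type*} [CommRing R] [Algebra R A] (E : Derivation R A A)
    (p : A[X]) : eulerDerivation E p = coeffDerivation E p + X * derivative p := by
  simp [eulerDerivation]

theorem eulerDerivation_flatPoly {R : Type*} [CommRing R] [Algebra R A] {E : Derivation R A A}
    {s : ℕ → A} (hE : ∀ g, E (s g) = ((g + 2 : ℕ) : A) * s g) (n : ℕ) :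
    eulerDerivation E (flatPoly s n) = n * flatPoly s n := by
  have hX : eulerDerivation E X = X := by simp [eulerDerivation_apply]
  have hC : ∀ g, eulerDerivation E (C (s g)) = ((g + 2 : ℕ) : A[X]) * C (s g) := fun g => by
    rw [eulerDerivation_apply, coeffDerivation_C, derivative_C, mul_zero, add_zero, hE, C_mul,
      map_natCast]
  induction n using Nat.strong_induction_on with
  | _ n ih =>
    cases n with
    | zero => simp
    | succ n =>
      rw [flatPoly_succ, map_add, Derivation.leibniz, hX, ih n (by omega), map_sum, mul_add,
        mul_sum]
      congr 1
      · simp only [smul_eq_mul]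
        push_cast
        ring
      · refine sum_congr rfl fun g hg => ?_
        rw [Derivation.leibniz, hC, ih _ (by omega), Nat.cast_sub (by simpa using hg)]
        simp only [smul_eq_mul]
        push_cast
        ring

theorem coeff_flatPoly (s : ℕ → A) {n m : ℕ} (h : n ≤ m + 1) :
    (flatPoly s n).coeff m = if m = n then 1 else 0 := by
  induction n using Nat.strong_induction_on generalizing m with
  | _ n ih =>
    cases n with
    | zero => rw [flatPoly_zero, coeff_one]
    | succ n =>
      rw [flatPoly_succ, coeff_add, finsetSum_coeff, sum_eq_zero, add_zero]
      · cases m with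
        | zero => simp
        | succ m => simp [coeff_X_mul, ih n (by omega) (by omega : n ≤ m + 1)]
      · intro g hg
        rw [mem_range] at hg
        rw [coeff_C_mul, ih _ (by omega) (by omega), if_neg (by omega), mul_zero]

theorem natDegree_flatPoly_le (s : ℕ → A) (n : ℕ) : (flatPoly s n).natDegree ≤ n := by
  rw [natDegree_le_iff_coeff_eq_zero]
  intro m hm
  rw [coeff_flatPoly s (by omega), if_neg (by omega)]

theorem monic_flatPoly (s : ℕ → A) (n : ℕ) : (flatPoly s n).Monic :=
  monic_of_natDegree_le_of_coeff_eq_one n (natDegree_flatPoly_le s n)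
    (by rw [coeff_flatPoly s (by omega), if_pos rfl])

theorem degree_flatPoly [Nontrivial A] (s : ℕ → A) (n : ℕ) : (flatPoly s n).degree = n :=
  le_antisymm (degree_le_of_natDegree_le (natDegree_flatPoly_le s n))
    (le_degree_of_ne_zero (by rw [coeff_flatPoly s (by omega), if_pos rfl]; exact one_ne_zero))

theorem degree_flatPoly_lt (s : ℕ → A) {n k : ℕ} (h : n < k) : (flatPoly s n).degree < k :=
  (degree_le_of_natDegree_le (natDegree_flatPoly_le s n)).trans_lt (by exact_mod_cast h)

theorem flatPoly_mul_flatPoly_mem_degreeLT (s : ℕ → A) {a b k : ℕ} (h : a + b < k) :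
    flatPoly s a * flatPoly s b ∈ degreeLT A k := by
  rw [mem_degreeLT]
  refine (degree_le_of_natDegree_le (natDegree_mul_le_of_le (natDegree_flatPoly_le s a)
    (natDegree_flatPoly_le s b))).trans_lt ?_
  exact_mod_cast h

theorem flatPoly_mul_flatPoly_exchange (s : ℕ → A) (a b : ℕ) :
    flatPoly s a * flatPoly s (b + 1) - flatPoly s (a + 1) * flatPoly s b =
      ∑ g ∈ range b, C (s g) * (flatPoly s a * flatPoly s (b - (g + 1))) -
        ∑ g ∈ range a, C (s g) * (flatPoly s (a - (g + 1)) * flatPoly s b) := by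
  simp only [← mul_assoc _ _ (flatPoly s b), mul_left_comm _ (flatPoly s a), ← mul_sum, ← sum_mul]
  rw [flatPoly_succ, flatPoly_succ]
  ring

theorem flatPoly_mul_sub_mem_degreeLT (s : ℕ → A) {M : ℕ} (n : ℕ) :
    ∀ {k a b : ℕ}, a + k + b = n → a + k ≤ M → b + k ≤ M →
      flatPoly s a * flatPoly s (b + k) - flatPoly s (a + k) * flatPoly s b ∈
        degreeLT A (M - 1) := by
  induction n using Nat.strong_induction_on with
  | _ n ih =>
    have hstep : ∀ a b, a ≤ b → b < M → a + b + 1 = n →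
        flatPoly s a * flatPoly s (b + 1) - flatPoly s (a + 1) * flatPoly s b ∈
          degreeLT A (M - 1) := by
      intro a b hab hb hn
      rw [flatPoly_mul_flatPoly_exchange, ← sum_range_add_sum_Ico _ hab, add_sub_right_comm,
        ← sum_sub_distrib]
      refine add_mem (sum_mem fun g hg => ?_) (sum_mem fun g hg => ?_)
      · rw [← mul_sub, C_mul']
        obtain ⟨c, rfl⟩ : ∃ c, a = c + (g + 1) := ⟨a - (g + 1), by grind⟩
        obtain ⟨d, rfl⟩ : ∃ d, b = d + (g + 1) := ⟨b - (g + 1), by grind⟩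
        rw [Nat.add_sub_cancel, Nat.add_sub_cancel, ← neg_sub]
        exact Submodule.smul_mem _ _ (neg_mem (ih (c + (g + 1) + d) (by omega) rfl
          (by omega) (by omega)))
      · rw [mem_Ico] at hg
        rw [C_mul']
        exact Submodule.smul_mem _ _ (flatPoly_mul_flatPoly_mem_degreeLT s (by omega))
    intro k a b hn ha hb
    have htel := sum_range_sub' (fun i => flatPoly s (a + i) * flatPoly s (b + (k - i))) k
    rw [Nat.sub_self, Nat.sub_zero, add_zero, add_zero] at htel
    rw [← htel]
    refine sum_mem fun i hi => ?_
    obtain ⟨l, rfl⟩ : ∃ l, k = i + 1 + l := ⟨k - (i + 1), by grind⟩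
    rw [show i + 1 + l - i = l + 1 by omega, Nat.add_sub_cancel_left, ← add_assoc, ← add_assoc]
    rcases le_total (a + i) (b + l) with h | h
    · exact hstep (a + i) (b + l) h (by omega) (by omega)
    · rw [mul_comm, mul_comm (flatPoly s (a + i + 1)), ← neg_sub]
      exact neg_mem (hstep (b + l) (a + i) h (by omega) (by omega))

/-- The quotient of the division of `Q_a Q_b` by `Q_N`, for `a, b < N`. -/
def flatQuotient (s : ℕ → A) (N a b : ℕ) : A[X] :=
  if N ≤ a + b then flatPoly s (a + b - N) else 0

theorem coeff_flatPoly_mul_sub (s : ℕ → A) {N a b m : ℕ} (ha : a < N) (hb : b < N)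
    (hm : N ≤ m + 1) :
    (flatPoly s a * flatPoly s b - flatQuotient s N a b * flatPoly s N).coeff m =
      if m + 1 = N ∧ a + b = m then 1 else 0 := by
  unfold flatQuotient
  split_ifs with hN htop htop
  · omega
  · obtain ⟨k, rfl⟩ : ∃ k, N = a + k := ⟨N - a, by omega⟩
    obtain ⟨c, rfl⟩ : ∃ c, b = c + k := ⟨b - k, by omega⟩
    have hmem := flatPoly_mul_sub_mem_degreeLT s (M := a + k) _ rfl le_rfl (by omega : c + k ≤ _)
    rw [show a + (c + k) - (a + k) = c by omega, mul_comm (flatPoly s c)]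
    exact degree_lt_iff_coeff_zero _ _ |>.1 (mem_degreeLT.1 hmem) m (by omega)
  · rw [zero_mul, sub_zero, ← htop.2, coeff_mul_add_eq_of_natDegree_le
      (natDegree_flatPoly_le s a) (natDegree_flatPoly_le s b), coeff_flatPoly s (by omega),
      coeff_flatPoly s (by omega), if_pos rfl, if_pos rfl, mul_one]
  · have hmem := flatPoly_mul_flatPoly_mem_degreeLT s (by omega : a + b < m)
    rw [zero_mul, sub_zero]
    exact coeff_eq_zero_of_degree_lt (mem_degreeLT.1 hmem)

theorem divByMonic_modByMonic_flatPoly [Nontrivial A] (s : ℕ → A) {N a b : ℕ} (ha : a < N)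
    (hb : b < N) :
    (flatPoly s a * flatPoly s b) /ₘ flatPoly s N = flatQuotient s N a b ∧
      (flatPoly s a * flatPoly s b) %ₘ flatPoly s N =
        flatPoly s a * flatPoly s b - flatQuotient s N a b * flatPoly s N := by
  refine div_modByMonic_unique _ _ (monic_flatPoly s N) ⟨by ring, ?_⟩
  rw [degree_flatPoly, degree_lt_iff_coeff_zero]
  intro m hm
  rw [coeff_flatPoly_mul_sub s ha hb (by omega), if_neg (by omega)]

/-- The residue of `p dx / M` at infinity, for `M` monic of degree `N`: the coefficient of
`x^{N-1}` in the remainder of the division of `p` by `M`. -/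
def residue (N : ℕ) (M : A[X]) : A[X] →ₗ[A] A :=
  lcoeff A (N - 1) ∘ₗ modByMonicHom M

theorem residue_apply (N : ℕ) (M p : A[X]) : residue N M p = (p %ₘ M).coeff (N - 1) := rfl

theorem residue_mul_self (N : ℕ) {M : A[X]} (hM : M.Monic) (p : A[X]) :
    residue N M (p * M) = 0 := by
  rw [residue_apply, mul_self_modByMonic hM, coeff_zero]

theorem residue_C_mul (N : ℕ) (M p : A[X]) (a : A) : residue N M (C a * p) = a * residue N M p := by
  rw [C_mul', map_smul, smul_eq_mul]

theorem residue_flatPoly_mul_flatPoly (s : ℕ → A) {N a b : ℕ} (ha : a < N) (hb : b < N) :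
    residue N (flatPoly s N) (flatPoly s a * flatPoly s b) = if a + b + 1 = N then 1 else 0 := by
  nontriviality A
  rw [residue_apply, (divByMonic_modByMonic_flatPoly s ha hb).2,
    coeff_flatPoly_mul_sub s ha hb (by omega)]
  exact if_congr (by omega) rfl rfl

theorem residue_sum_mul_flatPoly_rev (s : ℕ → A) {N : ℕ} (c : Fin N → A) (n : Fin N) :
    residue N (flatPoly s N) ((∑ m : Fin N, C (c m) * flatPoly s m) * flatPoly s n.rev) = c n := by
  have hterm : ∀ m : Fin N, residue N (flatPoly s N) (C (c m) * flatPoly s m * flatPoly s n.rev) =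
      if m = n then c m else 0 := fun m => by
    rw [mul_assoc, residue_C_mul, residue_flatPoly_mul_flatPoly s m.2 n.rev.2, mul_ite, mul_one,
      mul_zero]
    exact if_congr (by rw [Fin.val_rev, Fin.ext_iff]; omega) rfl rfl
  rw [sum_mul, map_sum, sum_congr rfl fun m _ => hterm m, sum_ite_eq' univ, if_pos (mem_univ n)]

theorem exists_eq_sum_flatPoly (s : ℕ → A) {k : ℕ} {p : A[X]} (hp : p.degree < k) :
    ∃ c : ℕ → A, p = ∑ n ∈ range k, C (c n) * flatPoly s n := by
  induction k generalizing p with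
  | zero =>
    rw [degree_lt_iff_coeff_zero] at hp
    exact ⟨0, by ext m; simpa using hp m (Nat.zero_le _)⟩
  | succ k ih =>
    have hlead : (p - C (p.coeff k) * flatPoly s k).degree < k := by
      rw [degree_lt_iff_coeff_zero] at hp ⊢
      intro m hm
      rw [coeff_sub, coeff_C_mul, coeff_flatPoly s (by omega)]
      rcases hm.eq_or_lt with rfl | hm
      · rw [if_pos rfl, mul_one, sub_self]
      · rw [if_neg (by omega), hp m hm, mul_zero, sub_zero]
    obtain ⟨c, hc⟩ := ih hlead
    refine ⟨Function.update c k (p.coeff k), ?_⟩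
    rw [sum_range_succ, Function.update_self, ← sub_eq_iff_eq_add, hc]
    refine sum_congr rfl fun n hn => ?_
    rw [Function.update_of_ne (mem_range.1 hn).ne]

theorem eq_sum_residue_mul_flatPoly (s : ℕ → A) {N : ℕ} {p : A[X]} (hp : p.degree < N) :
    p = ∑ n : Fin N, C (residue N (flatPoly s N) (p * flatPoly s n.rev)) * flatPoly s n := by
  obtain ⟨c, hc⟩ := exists_eq_sum_flatPoly s hp
  rw [sum_range] at hc
  conv_lhs => rw [hc]
  refine sum_congr rfl fun n _ => ?_
  rw [hc, residue_sum_mul_flatPoly_rev s fun m : Fin N => c m]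

end FlatPoly

/-! ### Euler fields and closed homogeneous forms -/

section Euler

open MvPolynomial

variable {σ R : Type*} [CommRing R]

theorem pderiv_pderiv_comm (i j : σ) (p : MvPolynomial σ R) :
    pderiv i (pderiv j p) = pderiv j (pderiv i p) := by
  classical
  have h : ⁅pderiv (R := R) i, pderiv j⁆ = 0 := derivation_ext fun k => by
    rw [Derivation.commutator_apply, pderiv_X, pderiv_X, Pi.single_apply, Pi.single_apply]
    split_ifs <;> simp
  rw [← sub_eq_zero, ← Derivation.commutator_apply, h, Derivation.zero_apply]

theorem derivation_sum_nsmul_mul {B : Type*} [CommRing B] [Algebra R B] [Fintype σ]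
    (D : Derivation R B B) (w : σ → ℕ) {x : σ → B} {e : σ} (hx : D (x e) = 1)
    (hx' : ∀ c, c ≠ e → D (x c) = 0) (g : σ → B) :
    D (∑ c, w c • (x c * g c)) = w e • g e + ∑ c, w c • (x c * D (g c)) := by
  have hterm : ∀ c, D (w c • (x c * g c)) = w c • (D (x c) * g c) + w c • (x c * D (g c)) :=
    fun c => by
      rw [map_nsmul, Derivation.leibniz, smul_eq_mul, smul_eq_mul, add_comm, smul_add,
        mul_comm (g c)]
  rw [map_sum, Finset.sum_congr rfl fun c _ => hterm c, Finset.sum_add_distrib,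
    Finset.sum_eq_single e (fun c _ hc => by rw [hx' c hc, zero_mul, smul_zero]) (by simp), hx,
    one_mul]

/-- The Euler vector field `∑ w_i x_i ∂/∂x_i` that gives the variable `x_i` the weight `w_i`. -/
def euler (w : σ → ℕ) : Derivation R (MvPolynomial σ R) (MvPolynomial σ R) :=
  mkDerivation R fun i => w i • X i

@[simp]
theorem euler_X (w : σ → ℕ) (i : σ) : euler (R := R) w (X i) = w i • X i :=
  mkDerivation_X _ _ _

theorem coeff_euler (w : σ → ℕ) (p : MvPolynomial σ R) (m : σ →₀ ℕ) :
    (euler w p).coeff m = Finsupp.weight w m • p.coeff m := by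
  classical
  induction p using MvPolynomial.induction_on' with
  | add p q hp hq => rw [map_add, coeff_add, coeff_add, hp, hq, smul_add]
  | monomial n r =>
    have hterm : ∀ i ∈ n.support, monomial (n - Finsupp.single i 1) (n i : R) • w i • X i =
        (n i • w i) • monomial n (1 : R) := fun i hi => by
      rw [smul_eq_mul, mul_smul_comm, X, monomial_mul, mul_one, tsub_add_cancel_of_le
        (Finsupp.single_le_iff.2 (Nat.one_le_iff_ne_zero.2 (Finsupp.mem_support_iff.1 hi))),
        ← nsmul_one (n i), map_nsmul, smul_smul, smul_eq_mul, mul_comm]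
    rw [euler, mkDerivation_monomial, Finsupp.sum, Finset.sum_congr rfl hterm, ← Finset.sum_smul,
      show ∑ i ∈ n.support, n i • w i = Finsupp.weight w n from (Finsupp.weight_apply w n).symm,
      smul_comm, smul_monomial, smul_eq_mul, mul_one, coeff_smul, coeff_monomial]
    split_ifs with h <;> simp [h]

theorem pderiv_euler (w : σ → ℕ) (i : σ) (p : MvPolynomial σ R) :
    pderiv i (euler w p) = euler w (pderiv i p) + w i • pderiv i p := by
  classical
  have h : ⁅pderiv (R := R) i, euler w⁆ = w i • pderiv i := derivation_ext fun j => by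
    rw [Derivation.commutator_apply, euler_X, map_nsmul, Derivation.smul_apply, pderiv_X,
      Pi.single_apply]
    split_ifs with hji <;> simp [hji]
  rw [← sub_eq_iff_eq_add', ← Derivation.commutator_apply, h, Derivation.smul_apply]

theorem euler_eq_sum [Fintype σ] (w : σ → ℕ) (p : MvPolynomial σ R) :
    euler w p = ∑ i, w i • (X i * pderiv i p) := by
  classical
  have h : euler w = ∑ i, (w i • X i : MvPolynomial σ R) • pderiv (R := R) i :=
    derivation_ext fun j => by
      rw [euler_X, ← Derivation.coeFnAddMonoidHom_apply, map_sum, Finset.sum_apply,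
        Finset.sum_eq_single j]
      · simp
      · intro i _ hi
        simp [pderiv_X_of_ne hi.symm]
      · simp
  rw [h, ← Derivation.coeFnAddMonoidHom_apply, map_sum, Finset.sum_apply]
  simp [Derivation.coeFnAddMonoidHom_apply, mul_assoc]

variable {K : Type*} [Field K] {w : σ → ℕ} {k : K}

theorem euler_pderiv_of_eq {p : MvPolynomial σ K} (hp : euler w p = k • p) (i : σ) :
    euler w (pderiv i p) = (k - w i) • pderiv i p := by
  rw [eq_sub_of_add_eq (pderiv_euler w i p).symm, hp, Derivation.map_smul, sub_smul,
    Nat.cast_smul_eq_nsmul]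

variable [Finite σ]

theorem eq_of_forall_pderiv_eq (hk : k ≠ 0) {p q : MvPolynomial σ K} (hp : euler w p = k • p)
    (hq : euler w q = k • q) (h : ∀ i, pderiv i p = pderiv i q) : p = q := by
  cases nonempty_fintype σ
  refine smul_right_injective _ hk ?_
  dsimp only
  rw [← hp, ← hq, euler_eq_sum, euler_eq_sum]
  simp only [h]

theorem eq_of_forall_third_pderiv_eq (hk : k ≠ 0) (hk₁ : ∀ i, k - w i ≠ 0)
    (hk₂ : ∀ i j, k - w i - w j ≠ 0) {p q : MvPolynomial σ K} (hp : euler w p = k • p)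
    (hq : euler w q = k • q)
    (h : ∀ i j l, pderiv i (pderiv j (pderiv l p)) = pderiv i (pderiv j (pderiv l q))) : p = q := by
  refine eq_of_forall_pderiv_eq hk hp hq fun i => ?_
  have hp₁ := euler_pderiv_of_eq hp i
  have hq₁ := euler_pderiv_of_eq hq i
  refine eq_of_forall_pderiv_eq (hk₁ i) hp₁ hq₁ fun j => ?_
  exact eq_of_forall_pderiv_eq (hk₂ i j) (euler_pderiv_of_eq hp₁ j) (euler_pderiv_of_eq hq₁ j)
    fun l => h l j i

theorem exists_primitive (hk : k ≠ 0) {g : σ → MvPolynomial σ K}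
    (hclosed : ∀ c e, pderiv e (g c) = pderiv c (g e))
    (hE : ∀ c, euler w (g c) = (k - w c) • g c) :
    ∃ F, (∀ e, pderiv e F = g e) ∧ euler w F = k • F := by
  cases nonempty_fintype σ
  have hpderiv : ∀ e, pderiv e (k⁻¹ • ∑ c, w c • (X c * g c)) = g e := fun e => by
    rw [Derivation.map_smul, derivation_sum_nsmul_mul (pderiv e) w (pderiv_X_self e)
      fun c hc => pderiv_X_of_ne hc]
    simp only [hclosed _ e]
    rw [← euler_eq_sum, hE, ← Nat.cast_smul_eq_nsmul K, ← add_smul, add_sub_cancel, smul_smul,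
      inv_mul_cancel₀ hk, one_smul]
  refine ⟨_, hpderiv, ?_⟩
  rw [euler_eq_sum, smul_inv_smul₀ hk]
  simp only [hpderiv]

theorem exists_third_primitive {c : σ → σ → σ → MvPolynomial σ K}
    (hswap : ∀ i j l, c i j l = c j i l) (hswap' : ∀ i j l, c i j l = c i l j)
    (hclosed : ∀ i j l m, pderiv m (c i j l) = pderiv l (c i j m))
    (hE : ∀ i j l, euler w (c i j l) = (k - w i - w j - w l) • c i j l)
    (hk : k ≠ 0) (hk₁ : ∀ i, k - w i ≠ 0) (hk₂ : ∀ i j, k - w i - w j ≠ 0) :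
    ∃ F, (∀ i j l, pderiv i (pderiv j (pderiv l F)) = c i j l) ∧ euler w F = k • F := by
  choose F₂ hF₂ hE₂ using fun i j => exists_primitive (hk₂ i j) (hclosed i j) (hE i j)
  have hF₂_symm : ∀ i j, F₂ i j = F₂ j i := fun i j =>
    eq_of_forall_pderiv_eq (hk₂ i j) (hE₂ i j)
      (by rw [sub_right_comm]; exact hE₂ j i) fun l => by rw [hF₂, hF₂, hswap]
  choose F₁ hF₁ hE₁ using fun i => exists_primitive (hk₁ i) (g := F₂ i)
    (fun j l => by rw [hF₂, hF₂, hswap']) (hE₂ i)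
  obtain ⟨F, hF, hEF⟩ := exists_primitive hk (g := F₁)
    (fun i j => by rw [hF₁, hF₁, hF₂_symm]) hE₁
  exact ⟨F, fun i j l => by rw [hF, hF₁, hF₂, hswap', hswap, hswap'], hEF⟩

end Euler

/-! ### Structure constants -/

section StructureConst

open Polynomial Finset

variable {A : Type*} [CommRing A] {s : ℕ → A} {N : ℕ}

local notation "Q" => flatPoly s
local notation "K" => flatQuotient s

variable (s) in
/-- The structure constants `η(∂_a ∘ ∂_b, ∂_c)`, the residues of `Q_a Q_b Q_c`. -/
def structureConst (a b c : Fin N) : A := residue N (Q N) (Q a * Q b * Q c)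

theorem structureConst_swap (a b c : Fin N) :
    structureConst s a b c = structureConst s b a c := by
  rw [structureConst, structureConst, mul_comm (Q a)]

theorem structureConst_swap_right (a b c : Fin N) :
    structureConst s a b c = structureConst s a c b := by
  rw [structureConst, structureConst, mul_right_comm]

theorem flatPoly_mul_sub_eq_sum (a b : Fin N) : Q a * Q b - K N a b * Q N =
    ∑ n : Fin N, C (structureConst s a b n.rev) * Q n := by
  have hdeg : (Q a * Q b - K N a b * Q N).degree < N := by
    rw [degree_lt_iff_coeff_zero]
    intro m hm
    rw [coeff_flatPoly_mul_sub s a.2 b.2 (by omega), if_neg (by omega)]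
  rw [eq_sum_residue_mul_flatPoly s hdeg]
  refine sum_congr rfl fun n _ => ?_
  rw [sub_mul, map_sub, mul_right_comm (K N a b), residue_mul_self N (monic_flatPoly s N),
    sub_zero, structureConst]

theorem flatPoly_mul_eq_sum (a b : Fin N) : Q a * Q b =
    ∑ n : Fin N, C (structureConst s a b n.rev) * Q n + K N a b * Q N := by
  rw [← flatPoly_mul_sub_eq_sum, sub_add_cancel]

theorem flatPoly_mul_mul_divByMonic (a b d : Fin N) : (Q a * Q b * Q d) /ₘ Q N =
    ∑ n : Fin N, C (structureConst s a b n.rev) * K N n d + K N a b * Q d := by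
  nontriviality A
  refine (div_modByMonic_unique _
    (∑ n : Fin N, C (structureConst s a b n.rev) * (Q n * Q d - K N n d * Q N))
    (monic_flatPoly s N) ⟨?_, ?_⟩).1
  · simp only [mul_sub, sum_sub_distrib, ← mul_assoc, ← sum_mul]
    linear_combination -flatPoly_mul_eq_sum (s := s) a b * Q d
  · rw [degree_flatPoly]
    refine mem_degreeLT.1 (sum_mem fun n _ => ?_)
    rw [C_mul', flatPoly_mul_sub_eq_sum]
    refine Submodule.smul_mem _ _ (sum_mem fun m _ => ?_)
    rw [C_mul']
    exact Submodule.smul_mem _ _ (mem_degreeLT.2 (degree_flatPoly_lt s m.2))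

section Derivations

variable {R : Type*} [CommRing R] [Algebra R A]

variable (s) in
/-- `d` acts on the coordinates `s_g = t_{N-g}` as the partial derivative `∂/∂t_{a+1}`. -/
def IsFlatDerivation (a : Fin N) (d : Derivation R A A) : Prop :=
  ∀ g, d (s g) = if g + a + 1 = N then 1 else 0

variable {a b : Fin N} {d e : Derivation R A A}

theorem IsFlatDerivation.coeffDerivation_flatPoly (hd : IsFlatDerivation s a d) (n : ℕ) :
    coeffDerivation d (Q n) = derivative (Q (n + a - N)) := by
  rw [Frob.coeffDerivation_flatPoly (j := N - (a + 1)) d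
    fun g => (hd g).trans (if_congr (by omega) rfl rfl)]
  congr 2
  omega

theorem IsFlatDerivation.coeffDerivation_flatPoly_self (hd : IsFlatDerivation s a d) :
    coeffDerivation d (Q N) = derivative (Q a) := by
  rw [hd.coeffDerivation_flatPoly, Nat.add_sub_cancel_left]

theorem IsFlatDerivation.coeffDerivation_flatPoly_symm (hd : IsFlatDerivation s a d)
    (he : IsFlatDerivation s b e) : coeffDerivation d (Q b) = coeffDerivation e (Q a) := by
  rw [hd.coeffDerivation_flatPoly, he.coeffDerivation_flatPoly, add_comm]

theorem IsFlatDerivation.derivative_flatQuotient (hd : IsFlatDerivation s a d) (n : ℕ) :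
    derivative (K N n a) = coeffDerivation d (Q n) := by
  rw [hd.coeffDerivation_flatPoly, flatQuotient]
  split_ifs with h
  · rfl
  · rw [show n + a - N = 0 by omega, flatPoly_zero, derivative_one, derivative_zero]

theorem sum_derivation_structureConst_mul (hd : IsFlatDerivation s a d)
    (he : IsFlatDerivation s b e) (c : Fin N) :
    ∑ n : Fin N, C (d (structureConst s c b n.rev)) * Q n =
      Q c * coeffDerivation d (Q b) + coeffDerivation d (Q c) * Q b + coeffDerivation e (Q c) * Q a
        - derivative ((Q c * Q b * Q a) /ₘ Q N) - coeffDerivation d (K N c b) * Q N := by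
  have hprod := congrArg (coeffDerivation d) (flatPoly_mul_eq_sum (s := s) c b)
  rw [Derivation.leibniz, map_add, map_sum, Derivation.leibniz, hd.coeffDerivation_flatPoly_self,
    sum_congr rfl fun (n : Fin N) _ => coeffDerivation_C_mul d _ (Q n), sum_add_distrib] at hprod
  simp only [smul_eq_mul] at hprod
  have hquot : derivative ((Q c * Q b * Q a) /ₘ Q N) =
      ∑ n : Fin N, C (structureConst s c b n.rev) * coeffDerivation d (Q n) +
        (coeffDerivation e (Q c) * Q a + K N c b * derivative (Q a)) := by
    rw [flatPoly_mul_mul_divByMonic, derivative_add, derivative_sum, derivative_mul,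
      he.derivative_flatQuotient]
    simp only [derivative_C_mul, hd.derivative_flatQuotient]
  linear_combination hquot - hprod

theorem IsFlatDerivation.structureConst_closed (hd : IsFlatDerivation s a d)
    (he : IsFlatDerivation s b e) (c l : Fin N) :
    d (structureConst s c b l) = e (structureConst s c a l) := by
  have hsum : ∑ n : Fin N, C (d (structureConst s c b n.rev)) * Q n -
      ∑ n : Fin N, C (e (structureConst s c a n.rev)) * Q n =
        (coeffDerivation e (K N c a) - coeffDerivation d (K N c b)) * Q N := by
    rw [sum_derivation_structureConst_mul hd he, sum_derivation_structureConst_mul he hd,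
      hd.coeffDerivation_flatPoly_symm he, mul_right_comm (Q c) (Q b)]
    ring
  have hres := congrArg (fun p => residue N (Q N) (p * Q l.rev.rev)) hsum
  simp only [sub_mul, map_sub] at hres
  rw [residue_sum_mul_flatPoly_rev s (fun n : Fin N => d (structureConst s c b n.rev)),
    residue_sum_mul_flatPoly_rev s (fun n : Fin N => e (structureConst s c a n.rev)),
    mul_right_comm, residue_mul_self N (monic_flatPoly s N), mul_right_comm,
    residue_mul_self N (monic_flatPoly s N), sub_zero, sub_eq_zero, Fin.rev_rev] at hres
  exact hres

theorem derivation_structureConst_of_homogeneous {E : Derivation R A A}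
    (hE : ∀ g, E (s g) = ((g + 2 : ℕ) : A) * s g) (a b c : Fin N) :
    E (structureConst s a b c) = ((a : A) + b + c + 1 - N) * structureConst s a b c := by
  have hterm : ∀ n : Fin N, eulerDerivation E (C (structureConst s a b n.rev) * Q n) =
      C (E (structureConst s a b n.rev) + (n : A) * structureConst s a b n.rev) * Q n := by
    intro n
    rw [Derivation.leibniz, eulerDerivation_flatPoly hE, eulerDerivation_apply,
      coeffDerivation_C, derivative_C, map_add, map_mul, map_natCast]
    simp only [smul_eq_mul]
    ring
  have hprod := congrArg (eulerDerivation E) (flatPoly_mul_eq_sum (s := s) a b)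
  rw [Derivation.leibniz, map_add, map_sum, Derivation.leibniz, sum_congr rfl fun n _ => hterm n,
    eulerDerivation_flatPoly hE, eulerDerivation_flatPoly hE, eulerDerivation_flatPoly hE] at hprod
  simp only [smul_eq_mul] at hprod
  have hsum : ∑ n : Fin N,
      C (E (structureConst s a b n.rev) + (n : A) * structureConst s a b n.rev) * Q n =
        C ((a : A) + b) * (Q a * Q b) - (N * K N a b + eulerDerivation E (K N a b)) * Q N := by
    rw [map_add, map_natCast, map_natCast]
    linear_combination -hprod
  have hres := congrArg (fun p => residue N (Q N) (p * Q c.rev.rev)) hsum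
  simp only [sub_mul, map_sub] at hres
  rw [residue_sum_mul_flatPoly_rev s (fun n : Fin N =>
      E (structureConst s a b n.rev) + (n : A) * structureConst s a b n.rev),
    mul_right_comm _ (Q N), residue_mul_self N (monic_flatPoly s N), mul_assoc, residue_C_mul,
    sub_zero, Fin.rev_rev, ← structureConst, Fin.val_rev, Nat.cast_sub (by omega)] at hres
  push_cast at hres
  linear_combination hres

end Derivations

end StructureConst

/-! ### Flat coordinates and the potential -/

section FlatCoordinates

open Polynomial

open MvPolynomial (pderiv)

/-- The weight `N + 2 - α` of the flat coordinate `t_α` and of the vector field `t_α ∂/∂t_α` in the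
Euler field, which is scaled by `N + 1` to make the weights integral. -/
def flatWeight {N : ℕ} (α : Fin N) : ℕ := N + 1 - α

/-- The flat coordinates in the order in which they occur in `flatPoly`: `s_g = t_{N-g}`, of weight
`g + 2`, and `s_g = 0` if `g ≥ N`. -/
def flatCoord (N g : ℕ) : Poly N := if h : g < N then MvPolynomial.X (Fin.rev ⟨g, h⟩) else 0

variable {N : ℕ}

local notation "Q" => flatPoly (flatCoord N)

theorem isFlatDerivation_pderiv (α : Fin N) : IsFlatDerivation (flatCoord N) α (pderiv α) := by
  intro g
  by_cases hg : g < N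
  · rw [flatCoord, dif_pos hg, MvPolynomial.pderiv_X, Pi.single_apply]
    exact if_congr (by rw [Fin.ext_iff, Fin.val_rev]; dsimp only; omega) rfl rfl
  · rw [flatCoord, dif_neg hg, map_zero, if_neg (by omega)]

theorem euler_flatCoord (g : ℕ) :
    euler flatWeight (flatCoord N g) = ((g + 2 : ℕ) : Poly N) * flatCoord N g := by
  by_cases hg : g < N
  · rw [flatCoord, dif_pos hg, euler_X, nsmul_eq_mul, flatWeight, Fin.val_rev]
    congr 2
    dsimp only
    omega
  · rw [flatCoord, dif_neg hg, map_zero, mul_zero]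

theorem constantCoeff_flatCoord (g : ℕ) : MvPolynomial.constantCoeff (flatCoord N g) = 0 := by
  unfold flatCoord
  split_ifs <;> simp

theorem map_constantCoeff_flatPoly (n : ℕ) : (Q n).map MvPolynomial.constantCoeff = X ^ n := by
  rw [map_flatPoly, flatPoly_of_eq_zero constantCoeff_flatCoord]

theorem coeffDerivation_euler (p : Polynomial (Poly N)) : coeffDerivation (euler flatWeight) p =
    ∑ α, flatWeight α • (C (MvPolynomial.X α) * coeffDerivation (pderiv α) p) := by
  ext1 n
  simp only [coeff_coeffDerivation, euler_eq_sum, finsetSum_coeff, coeff_smul, coeff_C_mul]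

theorem euler_flatPoly (n : ℕ) :
    ∑ α, flatWeight α • (C (MvPolynomial.X α) * coeffDerivation (pderiv α) (Q n)) +
      X * derivative (Q n) = n • Q n := by
  rw [← coeffDerivation_euler, ← eulerDerivation_apply, eulerDerivation_flatPoly euler_flatCoord,
    nsmul_eq_mul]

/-- The unfolding `Λ` in flat coordinates: its derivatives `∂Λ/∂x = Q_N` and `∂Λ/∂t_α = Q_{α-1}`
determine it by Euler's identity, since `Λ` is homogeneous of degree `N + 1`. -/
def flatUnfolding (N : ℕ) : Polynomial (Poly N) :=
  ((N : ℂ) + 1)⁻¹ • (X * flatPoly (flatCoord N) N +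
    ∑ α : Fin N, flatWeight α • (C (MvPolynomial.X α) * flatPoly (flatCoord N) α))

theorem derivative_flatUnfolding : derivative (flatUnfolding N) = Q N := by
  rw [flatUnfolding, derivative_smul, inv_smul_eq_iff₀ (by exact_mod_cast N.succ_ne_zero),
    derivative_add, derivative_mul, derivative_X, one_mul, add_smul, one_smul,
    Nat.cast_smul_eq_nsmul, ← euler_flatPoly, derivative_sum]
  simp only [derivative_smul, derivative_C_mul,
    (isFlatDerivation_pderiv _).coeffDerivation_flatPoly_self]
  ring

theorem coeffDerivation_flatUnfolding (α : Fin N) :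
    coeffDerivation (pderiv α) (flatUnfolding N) = Q α := by
  have hsum := derivation_sum_nsmul_mul (coeffDerivation (pderiv α)) flatWeight
    (x := fun β : Fin N => C (MvPolynomial.X β : Poly N)) (e := α)
    (by rw [coeffDerivation_C, MvPolynomial.pderiv_X_self, C_1])
    (fun β hβ => by rw [coeffDerivation_C, MvPolynomial.pderiv_X_of_ne hβ, C_0]) (fun β => Q β)
  simp only [fun β => (isFlatDerivation_pderiv α).coeffDerivation_flatPoly_symm
    (isFlatDerivation_pderiv β)] at hsum
  have hweight : N + 1 = flatWeight α + α := by
    rw [flatWeight]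
    omega
  rw [flatUnfolding, Derivation.map_smul, inv_smul_eq_iff₀ (by exact_mod_cast N.succ_ne_zero),
    map_add, Derivation.leibniz, coeffDerivation_X, smul_zero, add_zero, smul_eq_mul, hsum,
    (isFlatDerivation_pderiv α).coeffDerivation_flatPoly_self, ← Nat.cast_succ,
    Nat.cast_smul_eq_nsmul, Nat.succ_eq_add_one, hweight, add_smul, ← euler_flatPoly]
  ring

/-- The unfolding parameters `v_k` as functions of the flat coordinates. -/
def flatParam (N : ℕ) (k : Fin N) : Poly N := (flatUnfolding N).coeff k

theorem coeff_flatUnfolding_succ {m : ℕ} (hm : N ≤ m + 1) : (flatUnfolding N).coeff (m + 1) =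
    if m = N then MvPolynomial.C (1 / ((N : ℂ) + 1)) else 0 := by
  have hderiv := coeff_flatPoly (flatCoord N) hm
  rw [← derivative_flatUnfolding, coeff_derivative] at hderiv
  refine mul_right_cancel₀ (b := (m : Poly N) + 1) (by exact_mod_cast m.succ_ne_zero) ?_
  rw [hderiv, ite_mul, zero_mul]
  refine if_ctx_congr Iff.rfl (fun h => ?_) fun _ => rfl
  have hm' : (m : Poly N) + 1 = MvPolynomial.C ((m : ℂ) + 1) := by simp
  rw [hm', ← h, ← map_mul, one_div_mul_cancel (by exact_mod_cast m.succ_ne_zero), map_one]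

theorem unfolding_flatParam (hN : 0 < N) : unfolding N (flatParam N) = flatUnfolding N := by
  ext1 m
  rw [unfolding, coeff_add, coeff_C_mul, coeff_X_pow, finsetSum_coeff]
  simp only [coeff_C_mul, coeff_X_pow]
  by_cases hm : m < N
  · rw [if_neg (by omega), mul_zero, zero_add, Finset.sum_eq_single ⟨m, hm⟩]
    · simp [flatParam]
    · intro k _ hk
      rw [if_neg fun h => hk (Fin.ext h.symm), mul_zero]
    · simp
  · obtain ⟨n, rfl⟩ : ∃ n, m = n + 1 := ⟨m - 1, by omega⟩
    rw [coeff_flatUnfolding_succ (by omega), Finset.sum_eq_zero, add_zero]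
    · simp
    · intro k _
      rw [if_neg (by omega), mul_zero]

theorem unfoldingDeriv_flatParam (hN : 0 < N) : unfoldingDeriv N (flatParam N) = Q N := by
  rw [unfoldingDeriv, unfolding_flatParam hN, derivative_flatUnfolding]

theorem coeff_tangent (v : Fin N → Poly N) (α k : Fin N) :
    (tangent N v α).coeff k = pderiv α (v k) := by
  rw [tangent, finsetSum_coeff, Finset.sum_eq_single k]
  · simp
  · intro l _ hl
    rw [coeff_C_mul, coeff_X_pow, if_neg fun h => hl (Fin.ext h.symm), mul_zero]
  · simp

theorem degree_tangent_lt (v : Fin N → Poly N) (α : Fin N) : (tangent N v α).degree < N := by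
  rw [degree_lt_iff_coeff_zero]
  intro m hm
  rw [tangent, finsetSum_coeff, Finset.sum_eq_zero]
  intro k _
  rw [coeff_C_mul, coeff_X_pow, if_neg (by omega), mul_zero]

theorem tangent_eq_of_coeff_eq {v : Fin N → Poly N} {α : Fin N} {p : Polynomial (Poly N)}
    (hp : p.degree < N) (h : ∀ k : Fin N, p.coeff k = pderiv α (v k)) : tangent N v α = p := by
  have htangent := degree_tangent_lt v α
  rw [degree_lt_iff_coeff_zero] at hp htangent
  ext1 m
  by_cases hm : m < N
  · exact (coeff_tangent v α ⟨m, hm⟩).trans (h ⟨m, hm⟩).symm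
  · rw [hp m (by omega), htangent m (by omega)]

theorem tangent_flatParam (α : Fin N) : tangent N (flatParam N) α = Q α :=
  tangent_eq_of_coeff_eq (degree_flatPoly_lt _ α.2) fun k => by
    rw [flatParam, ← coeff_coeffDerivation, coeffDerivation_flatUnfolding]

theorem circ_flatParam (α β : Fin N) :
    circ N (flatParam N) (tangent N (flatParam N) α) (tangent N (flatParam N) β) =
      ∑ γ : Fin N, C (structureConst (flatCoord N) α β γ) * tangent N (flatParam N) γ.rev := by
  rw [circ, tangent_flatParam, tangent_flatParam, unfoldingDeriv_flatParam (Fin.pos α),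
    (divByMonic_modByMonic_flatPoly _ α.2 β.2).2, flatPoly_mul_sub_eq_sum,
    ← Equiv.sum_comp Fin.revPerm]
  refine Finset.sum_congr rfl fun γ _ => ?_
  rw [tangent_flatParam, Fin.revPerm_apply, Fin.rev_rev]

theorem isFlat_flatParam (hN : 0 < N) : IsFlat N (flatParam N) where
  constantCoeff_eq k := by
    have hmap : (flatUnfolding N).map MvPolynomial.constantCoeff =
        ((N : ℂ) + 1)⁻¹ • (X ^ (N + 1) : Polynomial ℂ) := by
      ext1 m
      rw [coeff_map, flatUnfolding, coeff_smul, coeff_smul, MvPolynomial.constantCoeff_smul,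
        ← coeff_map, Polynomial.map_add, Polynomial.map_mul, map_constantCoeff_flatPoly, map_X,
        Polynomial.map_sum, Finset.sum_eq_zero fun α _ => by simp, add_zero, pow_succ']
    rw [flatParam, ← coeff_map, hmap, coeff_smul, coeff_X_pow, if_neg (by omega), smul_zero]
  linear_eq k α := by
    have hcoeff : MvPolynomial.constantCoeff (pderiv α (flatParam N k)) =
        if α = k then 1 else 0 := by
      rw [flatParam, ← coeff_coeffDerivation, coeffDerivation_flatUnfolding, ← coeff_map,
        map_constantCoeff_flatPoly, coeff_X_pow]
      exact if_congr (by rw [Fin.ext_iff, eq_comm]) rfl rfl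
    rw [← hcoeff, MvPolynomial.constantCoeff_eq, MvPolynomial.coeff_pderiv]
    simp
  eta_eq α β := by
    rw [eta, circ, tangent_flatParam, tangent_flatParam, unfoldingDeriv_flatParam hN,
      ← residue_apply, residue_flatPoly_mul_flatPoly _ α.2 β.2]
    exact if_congr (by rw [Fin.ext_iff, Fin.val_rev]; omega) rfl rfl

theorem eulerEquation_iff (F : Poly N) :
    (∑ α : Fin N, MvPolynomial.C (((N : ℂ) + 1 - (α : ℕ)) / ((N : ℂ) + 1)) *
      (MvPolynomial.X α * pderiv α F) =
    MvPolynomial.C (3 - ((N : ℂ) - 1) / ((N : ℂ) + 1)) * F) ↔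
    euler flatWeight F = (2 * (N : ℂ) + 4) • F := by
  have hN : (N : ℂ) + 1 ≠ 0 := by exact_mod_cast N.succ_ne_zero
  have hterm : ∀ α : Fin N, MvPolynomial.C (((N : ℂ) + 1 - (α : ℕ)) / ((N : ℂ) + 1)) *
      (MvPolynomial.X α * pderiv α F) =
        ((N : ℂ) + 1)⁻¹ • (flatWeight α • (MvPolynomial.X α * pderiv α F)) := fun α => by
    rw [MvPolynomial.C_mul', ← Nat.cast_smul_eq_nsmul ℂ, smul_smul, flatWeight,
      Nat.cast_sub (by omega), div_eq_inv_mul, Nat.cast_succ]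
  have hconst : 3 - ((N : ℂ) - 1) / ((N : ℂ) + 1) = ((N : ℂ) + 1)⁻¹ * (2 * (N : ℂ) + 4) := by
    field_simp
    ring
  rw [Finset.sum_congr rfl fun α _ => hterm α, ← Finset.smul_sum, ← euler_eq_sum,
    MvPolynomial.C_mul', hconst, mul_smul]
  exact (smul_right_injective _ (inv_ne_zero hN)).eq_iff

theorem natCast_flatWeight (α : Fin N) : (flatWeight α : ℂ) = N + 1 - α := by
  rw [flatWeight, Nat.cast_sub (by omega), Nat.cast_succ]

theorem potentialWeight_ne_zero : 2 * (N : ℂ) + 4 ≠ 0 := by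
  exact_mod_cast (2 * N + 3).succ_ne_zero

theorem potentialWeight_sub_ne_zero (α : Fin N) : 2 * (N : ℂ) + 4 - flatWeight α ≠ 0 := by
  rw [natCast_flatWeight]
  convert (Nat.cast_ne_zero (R := ℂ)).2 (N + α + 2).succ_ne_zero using 1
  push_cast
  ring

theorem potentialWeight_sub_sub (α β : Fin N) :
    2 * (N : ℂ) + 4 - flatWeight α - flatWeight β = (α + β + 2 : ℕ) := by
  rw [natCast_flatWeight, natCast_flatWeight]
  push_cast
  ring

theorem potentialWeight_sub_sub_ne_zero (α β : Fin N) :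
    2 * (N : ℂ) + 4 - flatWeight α - flatWeight β ≠ 0 := by
  rw [potentialWeight_sub_sub]
  exact Nat.cast_ne_zero.2 (Nat.succ_ne_zero _)

theorem euler_structureConst (α β γ : Fin N) :
    euler flatWeight (structureConst (flatCoord N) α β γ) =
      (2 * (N : ℂ) + 4 - flatWeight α - flatWeight β - flatWeight γ) •
        structureConst (flatCoord N) α β γ := by
  rw [derivation_structureConst_of_homogeneous euler_flatCoord, potentialWeight_sub_sub,
    natCast_flatWeight, MvPolynomial.smul_eq_C_mul]
  congr 1
  simp only [map_add, map_sub, map_natCast, map_one, Nat.cast_add, Nat.cast_ofNat, map_ofNat]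
  ring

theorem exists_pderiv_eq_structureConst : ∃ F : Poly N,
    (∀ α β γ, pderiv α (pderiv β (pderiv γ F)) = structureConst (flatCoord N) α β γ) ∧
      euler flatWeight F = (2 * (N : ℂ) + 4) • F := by
  refine exists_third_primitive structureConst_swap structureConst_swap_right
    (fun α β γ δ => ?_) euler_structureConst potentialWeight_ne_zero potentialWeight_sub_ne_zero
    potentialWeight_sub_sub_ne_zero
  rw [structureConst_swap_right, structureConst_swap_right α β δ]
  exact (isFlatDerivation_pderiv δ).structureConst_closed (isFlatDerivation_pderiv γ) α β

theorem exists_isPotentialA (hN : 0 < N) : ∃ F : Poly N, IsPotentialA N F := by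
  obtain ⟨F, hF, hE⟩ := exists_pderiv_eq_structureConst (N := N)
  refine ⟨F, ⟨flatParam N, isFlat_flatParam hN, fun α β => ?_⟩, (eulerEquation_iff F).2 hE⟩
  rw [circ_flatParam]
  exact Finset.sum_congr rfl fun γ _ => by rw [hF]

end FlatCoordinates

/-! ### Uniqueness of the flat coordinates and of the potential -/

section Uniqueness

open Polynomial

open MvPolynomial (pderiv idealOfVars)

section PowIdealOfVars

variable {σ R : Type*} [CommRing R]

theorem pderiv_mem_pow_idealOfVars {p : MvPolynomial σ R} {d : ℕ}
    (hp : p ∈ idealOfVars σ R ^ (d + 1)) (i : σ) : pderiv i p ∈ idealOfVars σ R ^ d := by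
  rw [MvPolynomial.mem_pow_idealOfVars_iff'] at hp ⊢
  intro m hm
  rw [MvPolynomial.coeff_pderiv, hp, zero_mul]
  rw [map_add, Finsupp.degree_single]
  omega

theorem mem_pow_idealOfVars_succ [CharZero R] [NoZeroDivisors R] {p : MvPolynomial σ R} {d : ℕ}
    (hp : MvPolynomial.constantCoeff p = 0) (h : ∀ i, pderiv i p ∈ idealOfVars σ R ^ d) :
    p ∈ idealOfVars σ R ^ (d + 1) := by
  simp only [MvPolynomial.mem_pow_idealOfVars_iff'] at h ⊢
  intro m hm
  by_cases hm₀ : m = 0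
  · rwa [hm₀]
  obtain ⟨i, hi⟩ := Finsupp.ne_iff.1 hm₀
  have hadd : m - Finsupp.single i 1 + Finsupp.single i 1 = m :=
    tsub_add_cancel_of_le (Finsupp.single_le_iff.2 (Nat.one_le_iff_ne_zero.2 hi))
  have hcoeff := h i (m - Finsupp.single i 1) (by
    rw [← hadd, map_add, Finsupp.degree_single] at hm
    omega)
  rw [MvPolynomial.coeff_pderiv, hadd] at hcoeff
  exact (mul_eq_zero.1 hcoeff).resolve_right (Nat.cast_add_one_ne_zero _)

end PowIdealOfVars

section Residue

variable {R A : Type*} [CommRing R] [CommRing A] [Algebra R A]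

theorem coeffDerivation_modByMonic [Nontrivial A] (d : Derivation R A A) {M : A[X]} (hM : M.Monic)
    (p : A[X]) :
    coeffDerivation d (p %ₘ M) = (coeffDerivation d p - (p /ₘ M) * coeffDerivation d M) %ₘ M := by
  have hdiv := congrArg (coeffDerivation d) (modByMonic_add_div p M)
  rw [map_add, Derivation.leibniz, smul_eq_mul, smul_eq_mul] at hdiv
  refine ((div_modByMonic_unique (coeffDerivation d (p /ₘ M)) _ hM ⟨?_, ?_⟩).2).symm
  · linear_combination hdiv
  · have hdeg := degree_modByMonic_lt p hM
    rw [degree_eq_natDegree hM.ne_zero] at hdeg ⊢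
    exact degree_coeffDerivation_lt d hdeg

theorem derivation_residue [Nontrivial A] (N : ℕ) (d : Derivation R A A) {M : A[X]} (hM : M.Monic)
    (p : A[X]) : d (residue N M p) =
      residue N M (coeffDerivation d p) - residue N M ((p /ₘ M) * coeffDerivation d M) := by
  rw [residue_apply, ← coeff_coeffDerivation, coeffDerivation_modByMonic d hM, ← map_sub,
    residue_apply]

theorem map_residue {B : Type*} [CommRing B] (N : ℕ) (φ : A →+* B) {M : A[X]} (hM : M.Monic)
    (p : A[X]) : φ (residue N M p) = residue N (M.map φ) (p.map φ) := by
  rw [residue_apply, residue_apply, ← map_modByMonic φ hM, coeff_map]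

end Residue

variable {N : ℕ}

theorem coeffDerivation_unfolding (v : Fin N → Poly N) (γ : Fin N) :
    coeffDerivation (pderiv γ) (unfolding N v) = tangent N v γ := by
  have hX : ∀ n : ℕ, coeffDerivation (pderiv γ) (X ^ n : Polynomial (Poly N)) = 0 := fun n => by
    rw [Derivation.leibniz_pow, coeffDerivation_X, smul_zero, smul_zero]
  rw [unfolding, tangent, map_add, coeffDerivation_C_mul, hX, map_sum, MvPolynomial.pderiv_C,
    map_zero, zero_mul, mul_zero, zero_add, zero_add]
  refine Finset.sum_congr rfl fun k _ => ?_
  rw [coeffDerivation_C_mul, hX, mul_zero, add_zero]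

theorem coeffDerivation_unfoldingDeriv (v : Fin N → Poly N) (γ : Fin N) :
    coeffDerivation (pderiv γ) (unfoldingDeriv N v) = derivative (tangent N v γ) := by
  rw [unfoldingDeriv, coeffDerivation_derivative, coeffDerivation_unfolding]

theorem coeffDerivation_tangent_comm (v : Fin N → Poly N) (α γ : Fin N) :
    coeffDerivation (pderiv γ) (tangent N v α) = coeffDerivation (pderiv α) (tangent N v γ) := by
  rw [← coeffDerivation_unfolding, ← coeffDerivation_unfolding,
    coeffDerivation_comm (pderiv_pderiv_comm γ α)]

/-- The residue pairing of `∂²Λ/∂t_γ∂t_α` and `∂Λ/∂t_β`: the Christoffel symbol of the connection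
that is trivial in the coordinates `v`. -/
def christoffel (v : Fin N → Poly N) (α γ β : Fin N) : Poly N :=
  residue N (unfoldingDeriv N v) (coeffDerivation (pderiv γ) (tangent N v α) * tangent N v β)

/-- Minus the derivative along `∂/∂t_γ` of the residue pairing of `∂Λ/∂t_α` and `∂Λ/∂t_β`, where
only the modulus `∂Λ/∂x` is differentiated. -/
def pairingDeriv (v : Fin N → Poly N) (α β γ : Fin N) : Poly N :=
  residue N (unfoldingDeriv N v)
    ((tangent N v α * tangent N v β) /ₘ unfoldingDeriv N v * derivative (tangent N v γ))

theorem christoffel_add_christoffel {v : Fin N → Poly N} (hv : IsFlat N v) (α β γ : Fin N) :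
    christoffel v α γ β + christoffel v β γ α = pairingDeriv v α β γ := by
  have hconst : pderiv γ (eta N v (tangent N v α) (tangent N v β)) = 0 := by
    rw [hv.eta_eq]
    split_ifs <;> simp
  rw [eta, circ, ← residue_apply, derivation_residue N _ (unfoldingDeriv_monic N v).1,
    coeffDerivation_unfoldingDeriv, sub_eq_zero, Derivation.leibniz, map_add, smul_eq_mul,
    smul_eq_mul, mul_comm (tangent N v α), add_comm, mul_comm (tangent N v β)] at hconst
  exact hconst

theorem two_mul_christoffel {v : Fin N → Poly N} (hv : IsFlat N v) (α γ β : Fin N) :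
    2 * christoffel v α γ β =
      pairingDeriv v α β γ + pairingDeriv v γ β α - pairingDeriv v α γ β := by
  have hsymm : ∀ a b c, christoffel v a b c = christoffel v b a c := fun a b c => by
    rw [christoffel, christoffel, coeffDerivation_tangent_comm]
  rw [← christoffel_add_christoffel hv, ← christoffel_add_christoffel hv,
    ← christoffel_add_christoffel hv, hsymm γ α β, hsymm β α γ, hsymm β γ α]
  ring

section Reduction

variable {B : Type*} [CommRing B] {π : Poly N →+* B} {v w : Fin N → Poly N}

theorem map_unfoldingDeriv_eq (h : ∀ k, π (v k) = π (w k)) :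
    (unfoldingDeriv N v).map π = (unfoldingDeriv N w).map π := by
  simp only [unfoldingDeriv, ← derivative_map, unfolding, Polynomial.map_add, Polynomial.map_sum,
    Polynomial.map_mul, map_C, h]

theorem map_tangent_eq (h : ∀ α k, π (pderiv α (v k)) = π (pderiv α (w k))) (α : Fin N) :
    (tangent N v α).map π = (tangent N w α).map π := by
  simp only [tangent, Polynomial.map_sum, Polynomial.map_mul, map_C, h]

theorem map_christoffel (π : Poly N →+* B) (v : Fin N → Poly N) (α γ β : Fin N) :
    π (christoffel v α γ β) = residue N ((unfoldingDeriv N v).map π)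
      ((coeffDerivation (pderiv γ) (tangent N v α)).map π * (tangent N v β).map π) := by
  rw [christoffel, map_residue N π (unfoldingDeriv_monic N v).1, Polynomial.map_mul]

theorem map_pairingDeriv (π : Poly N →+* B) (v : Fin N → Poly N) (α β γ : Fin N) :
    π (pairingDeriv v α β γ) = residue N ((unfoldingDeriv N v).map π)
      (((tangent N v α).map π * (tangent N v β).map π) /ₘ (unfoldingDeriv N v).map π *
        derivative ((tangent N v γ).map π)) := by
  rw [pairingDeriv, map_residue N π (unfoldingDeriv_monic N v).1, Polynomial.map_mul,
    map_divByMonic π (unfoldingDeriv_monic N v).1, Polynomial.map_mul, derivative_map]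

theorem map_christoffel_eq (hv : IsFlat N v) (hw : IsFlat N w) (h : ∀ k, π (v k) = π (w k))
    (h' : ∀ α k, π (pderiv α (v k)) = π (pderiv α (w k))) (α γ β : Fin N) :
    π (christoffel v α γ β) = π (christoffel w α γ β) := by
  have hpairing : ∀ a b c, π (pairingDeriv v a b c) = π (pairingDeriv w a b c) := fun a b c => by
    simp only [map_pairingDeriv, map_unfoldingDeriv_eq h, map_tangent_eq h']
  have htwo : IsUnit (π 2) := by
    have hunit : IsUnit (algebraMap ℂ (Poly N) 2) := (IsUnit.mk0 2 two_ne_zero).map _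
    rw [map_ofNat] at hunit
    exact hunit.map π
  refine htwo.mul_left_cancel ?_
  rw [← map_mul, ← map_mul, two_mul_christoffel hv, two_mul_christoffel hw]
  simp only [map_sub, map_add, hpairing]

/-- As the residue pairing is perfect, the Christoffel symbols determine the second derivatives. -/
theorem map_pderiv_pderiv_eq (hv : IsFlat N v) (h : ∀ k, π (v k) = π (flatParam N k))
    (h' : ∀ α k, π (pderiv α (v k)) = π (pderiv α (flatParam N k))) (α γ k : Fin N) :
    π (pderiv γ (pderiv α (v k))) = π (pderiv γ (pderiv α (flatParam N k))) := by
  have hN : 0 < N := Fin.pos k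
  set p : B[X] := (coeffDerivation (pderiv γ) (tangent N v α)).map π -
    (coeffDerivation (pderiv γ) (tangent N (flatParam N) α)).map π with hp
  have hdeg : p.degree < N :=
    (degree_sub_le _ _).trans_lt <| max_lt
      (degree_map_le.trans_lt (degree_coeffDerivation_lt _ (degree_tangent_lt _ _)))
      (degree_map_le.trans_lt (degree_coeffDerivation_lt _ (degree_tangent_lt _ _)))
  have hres : ∀ β : Fin N, residue N (flatPoly (fun g => π (flatCoord N g)) N)
      (p * flatPoly (fun g => π (flatCoord N g)) β) = 0 := fun β => by
    rw [← map_flatPoly, ← map_flatPoly, ← unfoldingDeriv_flatParam hN, ← tangent_flatParam, hp,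
      sub_mul, map_sub, ← map_christoffel, ← map_christoffel_eq hv (isFlat_flatParam hN) h h',
      map_christoffel, map_unfoldingDeriv_eq h, map_tangent_eq h' β, sub_self]
  have hzero : p = 0 := by
    rw [eq_sum_residue_mul_flatPoly (fun g => π (flatCoord N g)) hdeg]
    exact Finset.sum_eq_zero fun n _ => by rw [hres, C_0, zero_mul]
  have hcoeff := congrArg (fun q => q.coeff k) (sub_eq_zero.1 hzero)
  simpa only [coeff_map, coeff_coeffDerivation, coeff_tangent] using hcoeff

end Reduction

theorem IsFlat.eq_flatParam {v : Fin N → Poly N} (hv : IsFlat N v) : v = flatParam N := by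
  funext k
  have hw := isFlat_flatParam (Fin.pos k)
  have hconst : ∀ k, MvPolynomial.constantCoeff (v k - flatParam N k) = 0 := fun k => by
    rw [map_sub, hv.constantCoeff_eq, hw.constantCoeff_eq, sub_zero]
  have hlinear : ∀ k α, MvPolynomial.constantCoeff (pderiv α (v k - flatParam N k)) = 0 :=
    fun k α => by
      rw [MvPolynomial.constantCoeff_eq, MvPolynomial.coeff_pderiv, zero_add,
        MvPolynomial.coeff_sub, hv.linear_eq, hw.linear_eq, sub_self, zero_mul]
  have hmem : ∀ d k, v k - flatParam N k ∈ idealOfVars (Fin N) ℂ ^ (d + 1) := by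
    intro d
    induction d with
    | zero => exact fun k => mem_pow_idealOfVars_succ (hconst k) fun α => by simp
    | succ d ih =>
      refine fun k => mem_pow_idealOfVars_succ (hconst k) fun α =>
        mem_pow_idealOfVars_succ (hlinear k α) fun γ => ?_
      rw [map_sub, map_sub, ← Ideal.Quotient.eq]
      refine map_pderiv_pderiv_eq hv (fun l => ?_) (fun β l => ?_) α γ k
      · exact Ideal.Quotient.eq.2 (Ideal.pow_le_pow_right (by omega) (ih l))
      · rw [Ideal.Quotient.eq, ← map_sub]
        exact pderiv_mem_pow_idealOfVars (ih l) β
  rw [← sub_eq_zero]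
  ext m
  exact (MvPolynomial.mem_pow_idealOfVars_iff' _ _).1 (hmem m.degree k) m (by omega)

theorem IsPotentialA.pderiv_eq_structureConst {F : Poly N} (hF : IsPotentialA N F)
    (α β γ : Fin N) :
    pderiv α (pderiv β (pderiv γ F)) = structureConst (flatCoord N) α β γ := by
  obtain ⟨⟨v, hv, hcirc⟩, -⟩ := hF
  obtain rfl := hv.eq_flatParam
  have hres : ∀ c : Fin N → Poly N, residue N (flatPoly (flatCoord N) N)
      ((∑ n : Fin N, C (c n) * tangent N (flatParam N) n.rev) * flatPoly (flatCoord N) γ) =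
        c γ := fun c => by
    rw [← Equiv.sum_comp Fin.revPerm]
    simp only [Fin.revPerm_apply, Fin.rev_rev, tangent_flatParam]
    have := residue_sum_mul_flatPoly_rev (flatCoord N) (fun n => c n.rev) γ.rev
    simpa only [Fin.rev_rev] using this
  rw [← hres (structureConst (flatCoord N) α β), ← circ_flatParam, hcirc, hres]

theorem existsUnique_isPotentialA (hN : 0 < N) : ∃! F : Poly N, IsPotentialA N F := by
  obtain ⟨F, hF⟩ := exists_isPotentialA hN
  refine ⟨F, hF, fun G hG => eq_of_forall_third_pderiv_eq potentialWeight_ne_zero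
    potentialWeight_sub_ne_zero potentialWeight_sub_sub_ne_zero ((eulerEquation_iff G).1 hG.2)
    ((eulerEquation_iff F).1 hF.2) fun α β γ => ?_⟩
  rw [hG.pderiv_eq_structureConst, hF.pderiv_eq_structureConst]

theorem isPotentialA_FA (hN : 0 < N) : IsPotentialA N (FA N) := by
  have h := existsUnique_isPotentialA hN
  rw [FA, dif_pos h]
  exact h.choose_spec.1

end Uniqueness

/-! ### Second derivatives of the potential -/

section SecondDerivatives

open Polynomial Finset

open MvPolynomial (pderiv)

variable {B : Type*} [CommRing B]

/-- The recursion that determines the second derivatives of the potential `F_{A_{M+1}}`, each of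
them multiplied by its weight: `e a b` stands for `(a + b + 2) ∂²F / ∂t_{a+1} ∂t_{b+1}`, and `s` for
the flat coordinates in the order of `flatCoord`. -/
structure SecondDerivRecursion (s : ℕ → B) (e : ℕ → ℕ → B) (M : ℕ) : Prop where
  zero_left : ∀ n ≤ M, e 0 n = (n + 2) * s n
  succ_left : ∀ a b, a + b + 1 ≤ M → e (a + 1) b = e a (b + 1) -
    (∑ g ∈ range b, s g * e a (b - (g + 1)) - ∑ g ∈ range a, s g * e (a - (g + 1)) b)

namespace SecondDerivRecursion

variable {s s' : ℕ → B} {e e' : ℕ → ℕ → B} {M : ℕ}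

theorem map {B' : Type*} [CommRing B'] (φ : B →+* B') (h : SecondDerivRecursion s e M) :
    SecondDerivRecursion (fun g => φ (s g)) (fun a b => φ (e a b)) M where
  zero_left n hn := by rw [h.zero_left n hn, map_mul, map_add, map_natCast, map_ofNat]
  succ_left a b hab := by rw [h.succ_left a b hab]; simp only [map_sub, map_sum, map_mul]

theorem unique (h : SecondDerivRecursion s e M) (h' : SecondDerivRecursion s' e' M)
    (hs : ∀ g ≤ M, s g = s' g) {a b : ℕ} (hab : a + b ≤ M) : e a b = e' a b := by
  obtain ⟨m, hm⟩ : ∃ m, a + b = m := ⟨_, rfl⟩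
  induction m using Nat.strong_induction_on generalizing a b with
  | _ m ih =>
    induction a generalizing b with
    | zero => rw [h.zero_left b (by omega), h'.zero_left b (by omega), hs b (by omega)]
    | succ a iha =>
      rw [h.succ_left a b (by omega), h'.succ_left a b (by omega),
        iha (b := b + 1) (by omega) (by omega)]
      congr 2
      · refine sum_congr rfl fun g hg => ?_
        rw [mem_range] at hg
        rw [hs g (by omega), ih (a + (b - (g + 1))) (by omega) (by omega) rfl]
      · refine sum_congr rfl fun g hg => ?_
        rw [mem_range] at hg
        rw [hs g (by omega), ih (a - (g + 1) + b) (by omega) (by omega) rfl]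

end SecondDerivRecursion

theorem residue_flatPoly_mul_flatPoly_mul_succ (s : ℕ → B) (N : ℕ) (M p : B[X]) (a b : ℕ) :
    residue N M (flatPoly s (a + 1) * flatPoly s b * p) =
      residue N M (flatPoly s a * flatPoly s (b + 1) * p) -
        (∑ g ∈ range b, s g * residue N M (flatPoly s a * flatPoly s (b - (g + 1)) * p) -
          ∑ g ∈ range a, s g * residue N M (flatPoly s (a - (g + 1)) * flatPoly s b * p)) := by
  rw [← sub_sub_cancel (flatPoly s a * flatPoly s (b + 1)) (flatPoly s (a + 1) * flatPoly s b),
    flatPoly_mul_flatPoly_exchange]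
  simp only [sub_mul, sum_mul, mul_assoc, map_sub, map_sum, residue_C_mul]

variable {N : ℕ}

local notation "Q" => flatPoly (flatCoord N)

/-- The Euler field `∑_α (N + 2 - α) t_α ∂/∂t_α`, as an element of the Jacobian ring. -/
def eulerField (N : ℕ) : Polynomial (Poly N) :=
  ∑ α : Fin N, flatWeight α • (C (MvPolynomial.X α) * flatPoly (flatCoord N) α)

theorem residue_mul_eulerField (p : Polynomial (Poly N)) : residue N (Q N) (p * eulerField N) =
    ∑ α : Fin N, flatWeight α • (MvPolynomial.X α * residue N (Q N) (p * Q α)) := by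
  simp only [eulerField, mul_sum, map_sum, mul_smul_comm, map_nsmul, mul_left_comm p,
    residue_C_mul]

theorem residue_flatPoly_mul_eulerField {n : ℕ} (hn : n < N) :
    residue N (Q N) (Q n * eulerField N) = (n + 2) * flatCoord N n := by
  rw [residue_mul_eulerField, sum_eq_single (Fin.rev ⟨n, hn⟩), flatCoord, dif_pos hn,
    residue_flatPoly_mul_flatPoly _ hn (Fin.isLt _),
    if_pos (by rw [Fin.val_rev]; dsimp only; omega), mul_one, nsmul_eq_mul, flatWeight,
    Fin.val_rev]
  · rw [show N + 1 - (N - (n + 1)) = n + 2 by omega, Nat.cast_add, Nat.cast_ofNat]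
  · intro α _ hα
    rw [residue_flatPoly_mul_flatPoly _ hn α.isLt, if_neg, mul_zero, smul_zero]
    exact fun h => hα (Fin.ext (by rw [Fin.val_rev]; dsimp only; omega))
  · simp only [mem_univ, not_true_eq_false, false_implies]

theorem secondDerivRecursion_residue_eulerField {M : ℕ} (hM : M < N) :
    SecondDerivRecursion (flatCoord N)
      (fun a b => residue N (Q N) (Q a * Q b * eulerField N)) M where
  zero_left n hn := by rw [flatPoly_zero, one_mul, residue_flatPoly_mul_eulerField (hn.trans_lt hM)]
  succ_left a b _ := residue_flatPoly_mul_flatPoly_mul_succ _ _ _ _ a b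

theorem euler_pderiv_pderiv_FA (α β : Fin N) :
    euler flatWeight (pderiv α (pderiv β (FA N))) =
      ((α + β + 2 : ℕ) : ℂ) • pderiv α (pderiv β (FA N)) := by
  rw [euler_pderiv_of_eq (euler_pderiv_of_eq
    ((eulerEquation_iff _).1 (isPotentialA_FA (Fin.pos α)).2) β) α, potentialWeight_sub_sub,
    add_comm (β : ℕ)]

theorem smul_pderiv_pderiv_FA (α β : Fin N) :
    ((α + β + 2 : ℕ) : ℂ) • pderiv α (pderiv β (FA N)) =
      residue N (Q N) (Q α * Q β * eulerField N) := by
  rw [← euler_pderiv_pderiv_FA, euler_eq_sum, residue_mul_eulerField]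
  refine sum_congr rfl fun γ _ => ?_
  rw [(isPotentialA_FA (Fin.pos α)).pderiv_eq_structureConst, structureConst_swap,
    structureConst_swap_right, structureConst]

end SecondDerivatives

/-! ### Taylor expansion over compositions -/

section Taylor

open MvPolynomial Finset

variable {σ R : Type*} [CommRing R]

/-- The iterated partial derivative in the variables of the list `l`. -/
def iterPderiv (l : List σ) : MvPolynomial σ R →ₗ[R] MvPolynomial σ R :=
  (l.map fun i => ((pderiv i).toLinearMap : Module.End R (MvPolynomial σ R))).prod

@[simp]
theorem iterPderiv_nil (p : MvPolynomial σ R) : iterPderiv [] p = p := rfl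

theorem iterPderiv_cons (i : σ) (l : List σ) (p : MvPolynomial σ R) :
    iterPderiv (i :: l) p = pderiv i (iterPderiv l p) := rfl

theorem iterPderiv_cons' (i : σ) (l : List σ) (p : MvPolynomial σ R) :
    iterPderiv (i :: l) p = iterPderiv l (pderiv i p) := by
  rw [iterPderiv_cons]
  induction l with
  | nil => rfl
  | cons j l ih => rw [iterPderiv_cons, iterPderiv_cons, pderiv_pderiv_comm, ih]

theorem constantCoeff_euler (w : σ → ℕ) (p : MvPolynomial σ R) :
    constantCoeff (euler w p) = 0 := by
  rw [constantCoeff_eq, coeff_euler, map_zero, zero_smul]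

theorem euler_iterPderiv_of_eq {K : Type*} [Field K] {w : σ → ℕ} {k : K} {p : MvPolynomial σ K}
    (hp : euler w p = k • p) (l : List σ) :
    euler w (iterPderiv l p) = (k - (l.map w).sum) • iterPderiv l p := by
  induction l with
  | nil => rw [List.map_nil, List.sum_nil, Nat.cast_zero, sub_zero, iterPderiv_nil, hp]
  | cons i l ih =>
    rw [iterPderiv_cons, euler_pderiv_of_eq ih, List.map_cons, List.sum_cons, Nat.cast_add,
      sub_sub, add_comm (_ : K)]

theorem constantCoeff_iterPderiv_of_euler_eq {K : Type*} [Field K] {w : σ → ℕ} {k : K}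
    {p : MvPolynomial σ K} (hp : euler w p = k • p) {l : List σ} (hl : ((l.map w).sum : K) ≠ k) :
    constantCoeff (iterPderiv l p) = 0 := by
  have h := constantCoeff_euler w (iterPderiv l p)
  rw [euler_iterPderiv_of_eq hp, constantCoeff_smul, smul_eq_mul] at h
  exact (mul_eq_zero.1 h).resolve_left (sub_ne_zero.2 hl.symm)

theorem totalDegree_le_of_euler_eq {K : Type*} [Field K] [CharZero K] {w : σ → ℕ} {n : ℕ}
    {p : MvPolynomial σ K} (hw : ∀ i, w i ≠ 0) (hp : euler w p = (n : K) • p) :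
    p.totalDegree ≤ n := by
  refine Finset.sup_le fun m hm => ?_
  have h := congrArg (coeff m) hp
  rw [coeff_euler, coeff_smul, ← Nat.cast_smul_eq_nsmul K] at h
  have hweight : Finsupp.weight w m = n := by
    exact_mod_cast smul_left_injective K (mem_support_iff.1 hm) h
  rw [← hweight, Finsupp.weight_apply]
  exact Finset.sum_le_sum fun i _ => Nat.le_mul_of_pos_right _ (Nat.pos_of_ne_zero (hw i))

theorem pderiv_homogeneousComponent_succ (m : ℕ) (i : σ) (p : MvPolynomial σ R) :
    pderiv i (homogeneousComponent (m + 1) p) = homogeneousComponent m (pderiv i p) := by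
  ext x
  rw [coeff_pderiv, coeff_homogeneousComponent, coeff_homogeneousComponent, coeff_pderiv, map_add,
    Finsupp.degree_single, ite_mul, zero_mul]
  exact if_congr (by omega) rfl rfl

variable {T : Type*} [CommRing T]

section Fintype

variable [Algebra R T] [Fintype σ]

/-- `m!` times the part of degree `m` of the Taylor expansion `p(u) = p(0) + ∑_i u_i ∂_i p(0) + ⋯`
(see `taylorPart_eq`). -/
def taylorPart (u : σ → T) (m : ℕ) (p : MvPolynomial σ R) : T :=
  ∑ f : Fin m → σ, constantCoeff (iterPderiv (List.ofFn f) p) • ((List.ofFn f).map u).prod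

theorem taylorPart_succ (u : σ → T) (m : ℕ) (p : MvPolynomial σ R) :
    taylorPart u (m + 1) p = ∑ i, u i * taylorPart u m (pderiv i p) := by
  rw [taylorPart, ← (Fin.consEquiv fun _ => σ).sum_comp, Fintype.sum_prod_type]
  refine sum_congr rfl fun i _ => ?_
  rw [taylorPart, mul_sum]
  refine sum_congr rfl fun f _ => ?_
  simp only [Fin.consEquiv_apply, List.ofFn_succ, Fin.cons_zero, Fin.cons_succ, List.map_cons,
    List.prod_cons, iterPderiv_cons', mul_smul_comm]

theorem taylorPart_eq (u : σ → T) (m : ℕ) (p : MvPolynomial σ R) :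
    taylorPart u m p = m.factorial • aeval u (homogeneousComponent m p) := by
  induction m generalizing p with
  | zero =>
    simp [taylorPart, Algebra.algebraMap_eq_smul_one, constantCoeff_eq]
  | succ m ih =>
    have hsum : ∑ i, u i * aeval u (pderiv i (homogeneousComponent (m + 1) p)) =
        (m + 1) • aeval u (homogeneousComponent (m + 1) p) := by
      rw [← map_nsmul, ← (homogeneousComponent_isHomogeneous (m + 1) p).sum_X_mul_pderiv, map_sum]
      simp only [map_mul, aeval_X]
    rw [taylorPart_succ]
    simp only [ih, ← pderiv_homogeneousComponent_succ, mul_smul_comm]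
    rw [← smul_sum, hsum, smul_smul, Nat.factorial_succ, mul_comm]

theorem sum_taylorPart {K : Type*} [Field K] [CharZero K] [Algebra K T] (u : σ → T) {n : ℕ}
    {p : MvPolynomial σ K} (hp : p.totalDegree ≤ n) :
    ∑ m ∈ range (n + 1), (1 / (m.factorial : K)) • taylorPart u m p = aeval u p := by
  have hterm : ∀ m, (1 / (m.factorial : K)) • taylorPart u m p =
      aeval u (homogeneousComponent m p) := fun m => by
    rw [taylorPart_eq, ← Nat.cast_smul_eq_nsmul K, smul_smul,
      one_div_mul_cancel (Nat.cast_ne_zero.2 m.factorial_ne_zero), one_smul]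
  simp only [hterm]
  rw [← map_sum]
  congr 1
  conv_rhs => rw [← sum_homogeneousComponent p]
  refine (sum_subset (range_mono (Nat.succ_le_succ hp)) fun m _ hm => ?_).symm
  exact homogeneousComponent_eq_zero m p (by rw [mem_range] at hm; omega)

theorem sum_composition_blocks {M : Type*} [AddCommMonoid M] {w : σ → ℕ} {n : ℕ}
    (hw : Function.Injective w) (hw₀ : ∀ i, 0 < w i) (hn : ∀ k, 0 < k → k ≤ n → ∃ i, w i = k)
    (g : List ℕ → M) : ∑ γ : Composition n, g γ.blocks = ∑ m ∈ range (n + 1),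
      ∑ f : Fin m → σ with ((List.ofFn f).map w).sum = n, g ((List.ofFn f).map w) := by
  rw [sum_sigma']
  symm
  refine sum_bij (fun p hp => ⟨(List.ofFn p.2).map w, fun hk => ?_, ?_⟩) ?_ ?_ ?_ ?_
  · obtain ⟨i, -, rfl⟩ := List.mem_map.1 hk
    exact hw₀ i
  · exact (mem_filter.1 (mem_sigma.1 hp).2).2
  · exact fun _ _ => mem_univ _
  · intro p _ q _ hpq
    exact List.equivSigmaTuple.symm.injective
      (List.map_injective_iff.2 hw (congrArg Composition.blocks hpq))
  · intro γ _
    have hrange : γ.blocks ∈ Set.range (List.map w) := by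
      rw [Set.range_list_map]
      exact fun k hk => hn k (γ.blocks_pos hk) (γ.blocks_le hk)
    obtain ⟨l, hl⟩ := hrange
    have hlen : l.length < n + 1 := by
      rw [← List.length_map (f := w), hl]
      exact Nat.lt_succ_of_le γ.length_le
    refine ⟨⟨l.length, l.get⟩, ?_, Composition.ext ?_⟩
    · rw [mem_sigma, mem_filter, List.ofFn_get, hl]
      exact ⟨mem_range.2 hlen, mem_univ _, γ.blocks_sum⟩
    · simp only [List.ofFn_get, hl]
  · exact fun _ _ => rfl

end Fintype

theorem sum_composition_iterPderiv [Finite σ] {K : Type*} [Field K] [CharZero K] [Algebra K T]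
    {w : σ → ℕ} {n : ℕ} (hw : Function.Injective w) (hw₀ : ∀ i, 0 < w i)
    (hn : ∀ k, 0 < k → k ≤ n → ∃ i, w i = k) {p : MvPolynomial σ K}
    (hp : euler w p = (n : K) • p) (c : List ℕ → K)
    (hc : ∀ l : List σ, c (l.map w) = constantCoeff (iterPderiv l p)) (U : ℕ → T) :
    ∑ γ : Composition n, (1 / (γ.blocks.length.factorial : K) * c γ.blocks) •
      (γ.blocks.map U).prod = aeval (U ∘ w) p := by
  cases nonempty_fintype σ
  rw [← sum_taylorPart (U ∘ w) (totalDegree_le_of_euler_eq (fun i => (hw₀ i).ne') hp),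
    sum_composition_blocks hw hw₀ hn fun l =>
      (1 / (l.length.factorial : K) * c l) • (l.map U).prod]
  refine sum_congr rfl fun m _ => ?_
  rw [taylorPart, smul_sum, sum_filter]
  refine sum_congr rfl fun f _ => ?_
  rw [hc, List.map_map, List.length_map, List.length_ofFn, ← smul_smul]
  split_ifs with hf
  · rfl
  · rw [constantCoeff_iterPderiv_of_euler_eq hp fun h => hf (Nat.cast_injective h), zero_smul,
      smul_zero]

end Taylor

/-! ### The coefficients of the hierarchy of type `B` -/

section CoefficientsB

open MvPolynomial

variable {N : ℕ}

theorem dPoly_succ (i : Fin N) (p : Poly N) : dPoly N (i + 1) p = pderiv i p := by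
  rw [dPoly, dif_pos (by omega)]
  rfl

theorem foldr_dPoly (l : List (Fin N)) (p : Poly N) :
    (l.map fun i : Fin N => N - (i : ℕ)).foldr (fun g q => dPoly N (N + 1 - g) q) p =
      iterPderiv l p := by
  induction l with
  | nil => rfl
  | cons i l ih =>
    rw [List.map_cons, List.foldr_cons, ih, show N + 1 - (N - (i : ℕ)) = i + 1 by omega,
      dPoly_succ, iterPderiv_cons]

theorem derivation_algHom_of_X {σ R A : Type*} [CommRing R] [CommRing A] [Algebra R A]
    (D : Derivation R A A) (D' : Derivation R (MvPolynomial σ R) (MvPolynomial σ R))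
    (φ : MvPolynomial σ R →ₐ[R] A) (h : ∀ i, D (φ (X i)) = φ (D' (X i))) (p : MvPolynomial σ R) :
    D (φ p) = φ (D' p) := by
  induction p using MvPolynomial.induction_on with
  | C a => rw [← algebraMap_eq, AlgHom.commutes, Derivation.map_algebraMap,
      Derivation.map_algebraMap, map_zero]
  | add p q hp hq => rw [map_add, map_add, map_add, map_add, hp, hq]
  | mul_X p i hp =>
    rw [map_mul, Derivation.leibniz, Derivation.leibniz, hp, h, map_add]
    simp only [smul_eq_mul, map_mul]

/-- The substitution `F(t_1, …, t_{2N-1}) ↦ F(t_1, 0, t_2, 0, …, 0, t_N)`. -/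
def oddRestriction (N : ℕ) : Poly (2 * N - 1) →ₐ[ℂ] Poly N :=
  aeval fun j => if (j : ℕ) % 2 = 0 then X ⟨(j : ℕ) / 2, by omega⟩ else 0

theorem FB_eq_oddRestriction : FB N = oddRestriction N (FA (2 * N - 1)) := rfl

theorem oddRestriction_X_of_even {j : Fin (2 * N - 1)} {i : Fin N} (h : (j : ℕ) = 2 * i) :
    oddRestriction N (X j) = X i := by
  rw [oddRestriction, aeval_X, if_pos (by omega)]
  exact congrArg X (Fin.ext (by dsimp only; omega))

theorem oddRestriction_X_of_odd {j : Fin (2 * N - 1)} (h : (j : ℕ) % 2 ≠ 0) :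
    oddRestriction N (X j) = 0 := by
  rw [oddRestriction, aeval_X, if_neg h]

theorem pderiv_oddRestriction {j : Fin (2 * N - 1)} {i : Fin N} (h : (j : ℕ) = 2 * i)
    (p : Poly (2 * N - 1)) :
    pderiv i (oddRestriction N p) = oddRestriction N (pderiv j p) := by
  classical
  refine derivation_algHom_of_X _ _ _ (fun k => ?_) p
  by_cases hk : (k : ℕ) % 2 = 0
  · have hk' : (k : ℕ) = 2 * (⟨k / 2, by omega⟩ : Fin N) := by dsimp only; omega
    rw [oddRestriction_X_of_even hk', pderiv_X, pderiv_X, Pi.single_apply, Pi.single_apply,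
      apply_ite (oddRestriction N), map_one, map_zero]
    exact if_congr (by rw [Fin.ext_iff, Fin.ext_iff]; dsimp only; omega) rfl rfl
  · rw [oddRestriction_X_of_odd hk, map_zero, pderiv_X_of_ne, map_zero]
    rintro rfl
    omega

theorem two_smul_euler_oddRestriction (p : Poly (2 * N - 1)) :
    2 • euler (fun i : Fin N => N - (i : ℕ)) (oddRestriction N p) =
      oddRestriction N (euler flatWeight p) := by
  rw [← Derivation.smul_apply]
  refine derivation_algHom_of_X _ _ _ (fun k => ?_) p
  rw [euler_X, map_nsmul, Derivation.smul_apply]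
  by_cases hk : (k : ℕ) % 2 = 0
  · have hk' : (k : ℕ) = 2 * (⟨k / 2, by omega⟩ : Fin N) := by dsimp only; omega
    rw [oddRestriction_X_of_even hk', euler_X, smul_smul, flatWeight]
    congr 1
    dsimp only
    omega
  · rw [oddRestriction_X_of_odd hk, map_zero, smul_zero, smul_zero]

theorem pderiv_pderiv_FB (i j : Fin N) : pderiv i (pderiv j (FB N)) =
    oddRestriction N (pderiv ⟨2 * i, by omega⟩ (pderiv ⟨2 * j, by omega⟩ (FA (2 * N - 1)))) := by
  rw [FB_eq_oddRestriction, pderiv_oddRestriction (j := ⟨2 * j, _⟩) rfl,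
    pderiv_oddRestriction (j := ⟨2 * i, _⟩) rfl]

theorem euler_pderiv_pderiv_FB (i j : Fin N) :
    euler (fun k : Fin N => N - (k : ℕ)) (pderiv i (pderiv j (FB N))) =
      ((i + j + 1 : ℕ) : ℂ) • pderiv i (pderiv j (FB N)) := by
  refine smul_right_injective _ (two_ne_zero (α := ℕ)) ?_
  dsimp only
  rw [pderiv_pderiv_FB, two_smul_euler_oddRestriction, euler_pderiv_pderiv_FA, map_smul,
    ← Nat.cast_smul_eq_nsmul ℂ, smul_smul]
  congr 1
  push_cast
  ring

variable {T : Type*} [CommRing T] [Algebra ℂ T]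

theorem sum_RB (U : ℕ → T) (n m : ℕ) :
    ∑ γ : Composition (n + 1 + (m + 1) - 1), RB (n + 1) (m + 1) γ.blocks • (γ.blocks.map U).prod =
      aeval (fun k : Fin (n + 1 + (m + 1) + 1) => U (n + 1 + (m + 1) + 1 - k))
        (pderiv ⟨n, by omega⟩ (pderiv ⟨m, by omega⟩ (FB (n + 1 + (m + 1) + 1)))) := by
  set N := n + 1 + (m + 1) + 1
  refine sum_composition_iterPderiv (w := fun i : Fin N => N - (i : ℕ))
    (fun i j hij => Fin.ext ?_) (fun i => ?_) (fun k hk hkn => ⟨⟨N - k, by omega⟩, ?_⟩)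
    ((euler_pderiv_pderiv_FB _ _).trans ?_) (fun γ => constantCoeff
      (γ.foldr (fun g p => dPoly N (N + 1 - g) p) (dPoly N (n + 1) (dPoly N (m + 1) (FB N)))))
    (fun l => ?_) U
  · dsimp only at hij
    omega
  · omega
  · dsimp only
    omega
  · congr 2
    dsimp only
    omega
  · rw [foldr_dPoly]
    exact congrArg constantCoeff (congrArg (iterPderiv l)
      ((dPoly_succ ⟨n, _⟩ _).trans (congrArg _ (dPoly_succ ⟨m, _⟩ _))))

theorem aeval_oddRestriction_flatCoord (U : ℕ → T) {g : ℕ} (hg : g < 2 * N - 1) :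
    aeval (fun k : Fin N => U (N - k)) (oddRestriction N (flatCoord (2 * N - 1) g)) =
      if g % 2 = 0 then U (g / 2 + 1) else 0 := by
  rw [flatCoord, dif_pos hg]
  split_ifs with h
  · rw [oddRestriction_X_of_even (i := ⟨N - 1 - g / 2, by omega⟩)
      (by rw [Fin.val_rev]; dsimp only; omega), aeval_X]
    congr 1
    dsimp only
    omega
  · rw [oddRestriction_X_of_odd (by rw [Fin.val_rev]; dsimp only; omega), map_zero]

theorem smul_sum_RB {U : ℕ → T} {e : ℕ → ℕ → T} (n m : ℕ) (he : SecondDerivRecursion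
      (fun g => if g % 2 = 0 then U (g / 2 + 1) else 0) e (2 * (n + m))) :
    ((2 * (n + m + 1) : ℕ) : ℂ) • ∑ γ : Composition (n + 1 + (m + 1) - 1),
      RB (n + 1) (m + 1) γ.blocks • (γ.blocks.map U).prod = e (2 * n) (2 * m) := by
  set N := n + 1 + (m + 1) + 1
  set ρ : Poly (2 * N - 1) →ₐ[ℂ] T :=
    (aeval fun k : Fin N => U (N - k)).comp (oddRestriction N) with hρ
  have hrec := (secondDerivRecursion_residue_eulerField
    (show 2 * (n + m) < 2 * N - 1 by omega)).map ρ.toRingHom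
  have hcoord : ∀ g ≤ 2 * (n + m), ρ (flatCoord (2 * N - 1) g) =
      if g % 2 = 0 then U (g / 2 + 1) else 0 := fun g hg =>
    aeval_oddRestriction_flatCoord U (by omega)
  rw [← hrec.unique he hcoord (a := 2 * n) (b := 2 * m) (by omega), sum_RB, pderiv_pderiv_FB,
    ← AlgHom.comp_apply, ← hρ, ← map_smul]
  have hFA := smul_pderiv_pderiv_FA (⟨2 * n, by omega⟩ : Fin (2 * N - 1)) ⟨2 * m, by omega⟩
  rw [show 2 * (n + m + 1) = 2 * n + 2 * m + 2 by ring]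
  exact congrArg ρ hFA

end CoefficientsB

/-! ### Logarithmic derivatives of multivariate power series -/

section LogDerivative

open MvPowerSeries

variable {σ R B : Type*} [CommRing B]

theorem derivation_subst [CommRing R] [Algebra R B]
    (D : Derivation R (MvPowerSeries σ B) (MvPowerSeries σ B)) {F : MvPowerSeries σ B}
    (hF : constantCoeff F = 0) (f : PowerSeries R) :
    D (f.subst F) = (PowerSeries.derivative R f).subst F * D F := by
  have hs := PowerSeries.HasSubst.of_constantCoeff_zero hF
  set φ := PowerSeries.substAlgHom (R := R) hs with hφ
  have hpoly (p : Polynomial R) : D (φ p) = φ (PowerSeries.derivative R p) * D F := by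
    rw [PowerSeries.derivative_coe, PowerSeries.substAlgHom_coe, PowerSeries.substAlgHom_coe,
      Derivation.map_aeval, smul_eq_mul]
  rw [← PowerSeries.coe_substAlgHom hs, ← hφ]
  -- Writing `f = X ^ n * g + p` with a polynomial `p`, the defect of the chain rule for `f` is
  -- `F ^ n` times the defect for `g`.
  ext d
  obtain ⟨g, p, hfg⟩ : ∃ (g : PowerSeries R) (p : Polynomial R),
      f = ((Polynomial.X ^ (d.degree + 1) : Polynomial R) : PowerSeries R) * g + p :=
    ⟨_, _, by simpa using PowerSeries.eq_X_pow_mul_shift_add_trunc (d.degree + 1) f⟩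
  have hdefect : D (φ f) - φ (PowerSeries.derivative R f) * D F =
      F ^ (d.degree + 1) * (D (φ g) - φ (PowerSeries.derivative R g) * D F) := by
    rw [hfg]
    simp only [map_add, map_mul, Derivation.leibniz, hpoly, smul_eq_mul]
    rw [PowerSeries.substAlgHom_coe hs (Polynomial.X ^ _), map_pow, Polynomial.aeval_X]
    ring
  rw [← sub_eq_zero, ← map_sub, hdefect]
  refine coeff_of_lt_order (lt_of_lt_of_le ?_ ((le_self_add.trans
    (add_le_add_left (le_order_pow_of_constantCoeff_eq_zero _ hF) _)).trans le_order_mul))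
  exact_mod_cast Nat.lt_succ_self _

theorem constantCoeff_exp_subst [CommRing R] [Algebra ℚ R] [Algebra R B]
    {F : MvPowerSeries σ B} (hF : constantCoeff F = 0) :
    constantCoeff ((PowerSeries.exp R).subst F) = 1 := by
  rw [PowerSeries.constantCoeff_subst (PowerSeries.HasSubst.of_constantCoeff_zero hF),
    finsum_eq_single _ 0 fun n hn => by rw [map_pow, hF, zero_pow hn, smul_zero]]
  simp

theorem rescale_X (ε : σ → B) (i : σ) :
    rescale ε (X i : MvPowerSeries σ B) = C (ε i) * X i := by
  classical
  ext d
  rw [coeff_rescale, coeff_C_mul, coeff_X]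
  split_ifs with h
  · rw [h, Finsupp.prod_single_index (h := fun j m => ε j ^ m) (pow_zero _), pow_one]
  · rw [mul_zero, mul_zero]

theorem pderiv_rescale (ε : σ → B) (i : σ) (F : MvPowerSeries σ B) :
    pderiv B i (rescale ε F) = ε i • rescale ε (pderiv B i F) := by
  classical
  ext d
  rw [coeff_pderiv, coeff_smul, coeff_rescale, coeff_rescale, coeff_pderiv,
    Finsupp.prod_add_index' (h := fun j m => ε j ^ m) (fun _ => pow_zero _)
      fun _ _ _ => pow_add _ _ _,
    Finsupp.prod_single_index (h := fun j m => ε j ^ m) (pow_zero _), pow_one]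
  ring

theorem constantCoeff_rescale (ε : σ → B) (F : MvPowerSeries σ B) :
    constantCoeff (rescale ε F) = constantCoeff F := by
  rw [← coeff_zero_eq_constantCoeff_apply, coeff_rescale, Finsupp.prod_zero_index, one_mul,
    coeff_zero_eq_constantCoeff_apply]

theorem rescale_smul (ε : σ → B) (c : B) (F : MvPowerSeries σ B) :
    rescale ε (c • F) = c • rescale ε F := by
  simp only [← rescaleAlgHom_apply, map_smul]

theorem rescale_injective [IsDomain B] {ε : σ → B} (hε : ∀ i, ε i ≠ 0) :
    Function.Injective (rescale (R := B) ε) := by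
  intro F G h
  ext d
  have hd := congrArg (coeff d) h
  rw [coeff_rescale, coeff_rescale] at hd
  exact mul_left_cancel₀ (Finset.prod_ne_zero_iff.2 fun i _ => pow_ne_zero _ (hε i)) hd

theorem coeff_X_mul_pderiv (i : σ) (F : MvPowerSeries σ B) (d : σ →₀ ℕ) :
    coeff d (X i * pderiv B i F) = d i * coeff d F := by
  classical
  rw [X_def, coeff_monomial_mul, one_mul]
  split_ifs with h
  · rw [coeff_pderiv, tsub_add_cancel_of_le h, mul_comm, Finsupp.tsub_apply,
      Finsupp.single_eq_same, ← Nat.cast_add_one,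
      Nat.sub_add_cancel (Finsupp.single_le_iff.1 h)]
  · rw [Finsupp.single_le_iff, Nat.one_le_iff_ne_zero, not_not] at h
    rw [h, Nat.cast_zero, zero_mul]

variable [Fintype σ]

/-- The Euler operator `∑ i, X i * ∂/∂X i`, which multiplies the part of degree `n` of a power
series by `n`. -/
def eulerSeries : Derivation B (MvPowerSeries σ B) (MvPowerSeries σ B) :=
  ∑ i, (X i : MvPowerSeries σ B) • pderiv B i

theorem coeff_eulerSeries (F : MvPowerSeries σ B) (d : σ →₀ ℕ) :
    coeff d (eulerSeries F) = d.degree * coeff d F := by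
  have hsum : eulerSeries F = ∑ i, X i * pderiv B i F := by
    rw [eulerSeries, ← Derivation.coeFnAddMonoidHom_apply, map_sum, Finset.sum_apply]
    rfl
  rw [hsum, map_sum, Finsupp.degree_eq_sum, Nat.cast_sum, Finset.sum_mul]
  exact Finset.sum_congr rfl fun i _ => coeff_X_mul_pderiv i F d

theorem X_dvd_eulerSeries {i : σ} {F : MvPowerSeries σ B} (h : X i ∣ F) :
    X i ∣ eulerSeries F :=
  X_dvd_iff.2 fun d hd => by rw [coeff_eulerSeries, X_dvd_iff.1 h d hd, mul_zero]

theorem eulerSeries_rescale (ε : σ → B) (F : MvPowerSeries σ B) :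
    eulerSeries (rescale ε F) = rescale ε (eulerSeries F) := by
  ext d
  rw [coeff_eulerSeries, coeff_rescale, coeff_rescale, coeff_eulerSeries, mul_left_comm]

theorem eq_one_of_eulerSeries_eq_zero [IsAddTorsionFree B] {F : MvPowerSeries σ B}
    (h : eulerSeries F = 0) (h1 : constantCoeff F = 1) : F = 1 := by
  classical
  ext d
  rw [coeff_one]
  split_ifs with hd
  · rw [hd, coeff_zero_eq_constantCoeff_apply, h1]
  · have hdF := coeff_eulerSeries F d
    rw [h, map_zero, ← nsmul_eq_mul] at hdF
    exact (smul_eq_zero.1 hdF.symm).resolve_left ((Finsupp.degree_eq_zero_iff d).not.2 hd)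

/-- The logarithmic Euler derivative of a power series with constant coefficient `1`. -/
def logEuler (A : MvPowerSeries σ B) : MvPowerSeries σ B :=
  eulerSeries A * A.invOfUnit 1

variable {A A' : MvPowerSeries σ B}

theorem logEuler_mul_self (hA : constantCoeff A = 1) : logEuler A * A = eulerSeries A := by
  rw [logEuler, mul_assoc, invOfUnit_mul _ _ hA, mul_one]

theorem eq_logEuler_iff (hA : constantCoeff A = 1) {L : MvPowerSeries σ B} :
    L = logEuler A ↔ L * A = eulerSeries A := by
  rw [← logEuler_mul_self hA]
  exact (IsUnit.of_mul_eq_one _ (mul_invOfUnit A 1 hA)).mul_left_inj.symm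

theorem logEuler_mul (hA : constantCoeff A = 1) (hA' : constantCoeff A' = 1) :
    logEuler (A * A') = logEuler A + logEuler A' := by
  symm
  rw [eq_logEuler_iff (by rw [map_mul, hA, hA', one_mul]), Derivation.leibniz,
    ← logEuler_mul_self hA, ← logEuler_mul_self hA', smul_eq_mul, smul_eq_mul]
  ring

theorem logEuler_inj [IsAddTorsionFree B] (hA : constantCoeff A = 1)
    (hA' : constantCoeff A' = 1) : logEuler A = logEuler A' ↔ A = A' := by
  refine ⟨fun h => ?_, congrArg _⟩
  have hinv := mul_invOfUnit A' 1 hA'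
  have hc : constantCoeff (A'.invOfUnit 1) = 1 := by
    rw [constantCoeff_invOfUnit, inv_one, Units.val_one]
  have hone : A * A'.invOfUnit 1 = 1 := by
    refine eq_one_of_eulerSeries_eq_zero ?_ (by rw [map_mul, hA, hc, one_mul])
    rw [← logEuler_mul_self (by rw [map_mul, hA, hc, one_mul]), logEuler_mul hA hc, h,
      ← logEuler_mul hA' hc, hinv, logEuler, Derivation.map_one_eq_zero, zero_mul, zero_mul]
  linear_combination A' * hone - A * hinv

theorem rescale_logEuler (ε : σ → B) (hA : constantCoeff A = 1) :
    rescale ε (logEuler A) = logEuler (rescale ε A) := by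
  rw [eq_logEuler_iff, ← map_mul, logEuler_mul_self hA, eulerSeries_rescale]
  rw [constantCoeff_rescale, hA]

section Exp

variable [CommRing R] [Algebra ℚ R] [Algebra R B] {F : MvPowerSeries σ B}

theorem logEuler_exp_subst (hF : constantCoeff F = 0) :
    logEuler ((PowerSeries.exp R).subst F) = eulerSeries F := by
  symm
  rw [eq_logEuler_iff (constantCoeff_exp_subst hF), mul_comm]
  have h := derivation_subst ((eulerSeries (σ := σ) (B := B)).restrictScalars R) hF
    (PowerSeries.exp R)
  rw [PowerSeries.derivative_exp] at h
  exact h.symm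

theorem mul_exp_subst_eq_iff [IsAddTorsionFree B] (hA : constantCoeff A = 1)
    (hA' : constantCoeff A' = 1) (hF : constantCoeff F = 0) :
    A * (PowerSeries.exp R).subst F = A' ↔ eulerSeries F = logEuler A' - logEuler A := by
  have hE := constantCoeff_exp_subst (R := R) hF
  rw [← logEuler_inj (by rw [map_mul, hA, hE, one_mul]) hA', logEuler_mul hA hE,
    logEuler_exp_subst hF, eq_sub_iff_add_eq, add_comm]

end Exp

end LogDerivative

/-! ### The kernel `A` and its logarithmic derivative -/

section Kernel

open MvPowerSeries Finset

variable {B : Type*} [CommRing B]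

section AxisSeries

variable {σ : Type*}

theorem coeff_X_mul_of_eq_zero {i : σ} {d : σ →₀ ℕ} (hd : d i = 0) (F : MvPowerSeries σ B) :
    coeff d (X i * F) = 0 :=
  X_dvd_iff.1 (dvd_mul_right _ _) d hd

open Classical in
/-- The power series `∑ g, s g * X i ^ (g + 1)`. -/
def axisSeries (i : σ) (s : ℕ → B) : MvPowerSeries σ B := fun d =>
  if d i ≠ 0 ∧ d = Finsupp.single i (d i) then s (d i - 1) else 0

theorem coeff_axisSeries [DecidableEq σ] (i : σ) (s : ℕ → B) (d : σ →₀ ℕ) :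
    coeff d (axisSeries i s) =
      if d i ≠ 0 ∧ d = Finsupp.single i (d i) then s (d i - 1) else 0 := by
  rw [coeff_apply, axisSeries]
  congr

theorem coeff_axisSeries_mul (i : σ) (s : ℕ → B) (F : MvPowerSeries σ B) (d : σ →₀ ℕ) :
    coeff d (axisSeries i s * F) =
      ∑ g ∈ range (d i), s g * coeff (d - Finsupp.single i (g + 1)) F := by
  classical
  rw [coeff_mul]
  symm
  refine Finset.sum_of_injOn
    (fun g => (Finsupp.single i (g + 1), d - Finsupp.single i (g + 1))) ?_ ?_ ?_ ?_
  · intro a _ b _ hab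
    simpa using Finsupp.single_injective i (Prod.ext_iff.1 hab).1
  · intro g hg
    exact mem_coe.2 (HasAntidiagonal.mem_antidiagonal.2
      (add_tsub_cancel_of_le (Finsupp.single_le_iff.2 (mem_range.1 hg))))
  · rintro ⟨a, b⟩ hab hnot
    obtain rfl : a + b = d := HasAntidiagonal.mem_antidiagonal.1 hab
    rw [coeff_axisSeries, if_neg, zero_mul]
    rintro ⟨ha0, ha⟩
    refine hnot ⟨a i - 1, ?_, ?_⟩
    · simp only [coe_range, Set.mem_Iio, Finsupp.add_apply] at ha0 ⊢
      omega
    · simp only [Nat.sub_add_cancel (Nat.one_le_iff_ne_zero.2 ha0), ← ha, add_tsub_cancel_left]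
  · intro g _
    rw [coeff_axisSeries, if_pos (by simp)]
    simp

end AxisSeries

/-- The exponent of the monomial `X 0 ^ p * X 1 ^ q`. -/
def bidegree (p q : ℕ) : Fin 2 →₀ ℕ := Finsupp.single 0 p + Finsupp.single 1 q

section Bidegree

variable (p q r : ℕ) (F : MvPowerSeries (Fin 2) B)

@[simp] theorem bidegree_apply_zero : bidegree p q 0 = p := by simp [bidegree]

@[simp] theorem bidegree_apply_one : bidegree p q 1 = q := by simp [bidegree]

theorem eq_bidegree (d : Fin 2 →₀ ℕ) : d = bidegree (d 0) (d 1) := by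
  ext i
  fin_cases i <;> simp

@[simp] theorem bidegree_inj {p q p' q' : ℕ} : bidegree p q = bidegree p' q' ↔ p = p' ∧ q = q' :=
  ⟨fun h => ⟨by simpa using DFunLike.congr_fun h 0, by simpa using DFunLike.congr_fun h 1⟩,
    fun h => by rw [h.1, h.2]⟩

theorem single_zero_eq_bidegree : Finsupp.single 0 p = bidegree p 0 := by simp [bidegree]

theorem single_one_eq_bidegree : Finsupp.single 1 q = bidegree 0 q := by simp [bidegree]

theorem degree_bidegree : (bidegree p q).degree = p + q := by simp [bidegree]

theorem bidegree_sub_single_zero :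
    bidegree p q - Finsupp.single 0 r = bidegree (p - r) q := by
  rw [eq_bidegree (_ - _)]
  simp

theorem bidegree_sub_single_one :
    bidegree p q - Finsupp.single 1 r = bidegree p (q - r) := by
  rw [eq_bidegree (_ - _)]
  simp

theorem ext_bidegree {F G : MvPowerSeries (Fin 2) B}
    (h : ∀ p q, coeff (bidegree p q) F = coeff (bidegree p q) G) : F = G :=
  MvPowerSeries.ext fun d => by rw [eq_bidegree d, h]

@[simp] theorem coeff_bidegree_X_zero_mul :
    coeff (bidegree (p + 1) q) (X 0 * F) = coeff (bidegree p q) F := by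
  rw [show bidegree (p + 1) q = Finsupp.single 0 1 + bidegree p q by
    rw [bidegree, bidegree, Finsupp.single_add, add_comm (Finsupp.single 0 p), add_assoc],
    X_def, coeff_add_monomial_mul, one_mul]

@[simp] theorem coeff_bidegree_X_one_mul :
    coeff (bidegree p (q + 1)) (X 1 * F) = coeff (bidegree p q) F := by
  rw [show bidegree p (q + 1) = Finsupp.single 1 1 + bidegree p q by
    rw [bidegree, bidegree, Finsupp.single_add, add_comm (Finsupp.single 1 q), add_left_comm],
    X_def, coeff_add_monomial_mul, one_mul]

theorem coeff_bidegree_axisSeries_zero (s : ℕ → B) : coeff (bidegree p q) (axisSeries 0 s) =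
    if p ≠ 0 ∧ q = 0 then s (p - 1) else 0 := by
  classical
  rw [coeff_axisSeries, bidegree_apply_zero, single_zero_eq_bidegree]
  simp only [bidegree_inj, true_and]

theorem coeff_bidegree_axisSeries_one (s : ℕ → B) : coeff (bidegree p q) (axisSeries 1 s) =
    if q ≠ 0 ∧ p = 0 then s (q - 1) else 0 := by
  classical
  rw [coeff_axisSeries, bidegree_apply_one, single_one_eq_bidegree]
  simp only [bidegree_inj, and_true]

theorem coeff_bidegree_one : coeff (bidegree p q) (1 : MvPowerSeries (Fin 2) B) =
    if p = 0 ∧ q = 0 then 1 else 0 := by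
  classical
  rw [coeff_one, show (0 : Fin 2 →₀ ℕ) = bidegree 0 0 by simp [bidegree]]
  simp only [bidegree_inj]

end Bidegree

/-- The kernel `1 + ∑ s (p + q) * X 0 ^ (p + 1) * X 1 ^ (q + 1)`. -/
def kernelA (s : ℕ → B) : MvPowerSeries (Fin 2) B := fun d =>
  if d = 0 then 1 else if d 0 = 0 ∨ d 1 = 0 then 0 else s (d 0 - 1 + (d 1 - 1))

variable (s : ℕ → B)

theorem coeff_bidegree_kernelA (p q : ℕ) : coeff (bidegree p q) (kernelA s) =
    if p = 0 ∧ q = 0 then 1 else if p = 0 ∨ q = 0 then 0 else s (p - 1 + (q - 1)) := by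
  change (if bidegree p q = 0 then 1 else if bidegree p q 0 = 0 ∨ bidegree p q 1 = 0 then 0 else
    s (bidegree p q 0 - 1 + (bidegree p q 1 - 1))) = _
  rw [show (0 : Fin 2 →₀ ℕ) = bidegree 0 0 by simp [bidegree]]
  simp only [bidegree_inj, bidegree_apply_zero, bidegree_apply_one]

theorem constantCoeff_kernelA : constantCoeff (kernelA s) = 1 := rfl

theorem sub_mul_kernelA : (X 1 - X 0) * kernelA s =
    (X 1 - X 0) - X 0 * (X 1 * (axisSeries 0 s - axisSeries 1 s)) := by
  suffices h : X 1 * kernelA s - X 0 * kernelA s = X 1 * 1 - X 0 * 1 -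
      X 0 * (X 1 * axisSeries 0 s) + X 0 * (X 1 * axisSeries 1 s) by linear_combination h
  refine ext_bidegree fun p q => ?_
  rcases p with _ | _ | p <;> rcases q with _ | _ | q <;>
    simp [-mul_one, coeff_X_mul_of_eq_zero, coeff_bidegree_kernelA, coeff_bidegree_one,
      coeff_bidegree_axisSeries_zero, coeff_bidegree_axisSeries_one, add_right_comm, add_assoc]

theorem X_dvd_kernelA_sub_one (i : Fin 2) : X i ∣ kernelA s - 1 := by
  refine X_dvd_iff.2 fun d hd => ?_
  rw [eq_bidegree d, map_sub, coeff_bidegree_kernelA, coeff_bidegree_one]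
  fin_cases i <;> simp_all

theorem X_dvd_logEuler_kernelA (i : Fin 2) : X i ∣ logEuler (kernelA s) := by
  have h := X_dvd_eulerSeries (X_dvd_kernelA_sub_one s i)
  rw [map_sub, Derivation.map_one_eq_zero, sub_zero] at h
  exact dvd_mul_of_dvd_left h _

theorem coeff_axisSeries_zero_mul_logEuler_kernelA (a b : ℕ) :
    coeff (bidegree (a + 1) (b + 1)) (axisSeries 0 s * logEuler (kernelA s)) =
      ∑ g ∈ range a, s g * coeff (bidegree (a - (g + 1) + 1) (b + 1)) (logEuler (kernelA s)) := by
  rw [coeff_axisSeries_mul, bidegree_apply_zero, sum_range_succ, bidegree_sub_single_zero,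
    X_dvd_iff.1 (X_dvd_logEuler_kernelA s 0) _ (by simp), mul_zero, add_zero]
  refine sum_congr rfl fun g hg => ?_
  rw [bidegree_sub_single_zero, Nat.sub_add_comm (mem_range.1 hg)]

theorem coeff_axisSeries_one_mul_logEuler_kernelA (a b : ℕ) :
    coeff (bidegree (a + 1) (b + 1)) (axisSeries 1 s * logEuler (kernelA s)) =
      ∑ g ∈ range b, s g * coeff (bidegree (a + 1) (b - (g + 1) + 1)) (logEuler (kernelA s)) := by
  rw [coeff_axisSeries_mul, bidegree_apply_one, sum_range_succ, bidegree_sub_single_one,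
    X_dvd_iff.1 (X_dvd_logEuler_kernelA s 1) _ (by simp), mul_zero, add_zero]
  refine sum_congr rfl fun g hg => ?_
  rw [bidegree_sub_single_one, Nat.sub_add_comm (mem_range.1 hg)]

theorem secondDerivRecursion_logEuler_kernelA (M : ℕ) : SecondDerivRecursion s
    (fun a b => coeff (bidegree (a + 1) (b + 1)) (logEuler (kernelA s))) M := by
  set L := logEuler (kernelA s)
  have hθ := logEuler_mul_self (constantCoeff_kernelA s)
  have hcoeff (p q : ℕ) : coeff (bidegree (p + 1) (q + 1)) (eulerSeries (kernelA s)) =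
      (p + q + 2) * s (p + q) := by
    rw [coeff_eulerSeries, degree_bidegree, coeff_bidegree_kernelA]
    simp
    ring
  refine ⟨fun n _ => ?_, fun a b _ => ?_⟩
  · have hdvd : X 0 ^ 2 ∣ L * (kernelA s - 1) := by
      rw [sq]
      exact mul_dvd_mul (X_dvd_logEuler_kernelA s 0) (X_dvd_kernelA_sub_one s 0)
    have h := X_pow_dvd_iff.1 hdvd (bidegree (0 + 1) (n + 1)) (by simp)
    rw [mul_sub, mul_one, hθ, map_sub, hcoeff, sub_eq_zero] at h
    rw [← h]
    push_cast
    ring_nf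
  · have h : X 1 * L - X 0 * L - X 0 * (X 1 * (axisSeries 0 s * L)) +
        X 0 * (X 1 * (axisSeries 1 s * L)) =
        X 1 * eulerSeries (kernelA s) - X 0 * eulerSeries (kernelA s) := by
      linear_combination (X 1 - X 0) * hθ - L * sub_mul_kernelA s
    have hab := congrArg (coeff (bidegree (a + 2) (b + 2))) h
    simp only [map_add, map_sub, coeff_bidegree_X_zero_mul, coeff_bidegree_X_one_mul, hcoeff] at hab
    rw [coeff_axisSeries_zero_mul_logEuler_kernelA, coeff_axisSeries_one_mul_logEuler_kernelA,
      ← add_assoc a b 1, add_right_comm a 1 b] at hab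
    push_cast at hab
    linear_combination hab

theorem coeff_bidegree_rescale (u v : B) (F : MvPowerSeries (Fin 2) B) (p q : ℕ) :
    coeff (bidegree p q) (rescale ![u, v] F) = u ^ p * v ^ q * coeff (bidegree p q) F := by
  rw [coeff_rescale, Finsupp.prod_fintype _ _ fun _ => pow_zero _, Fin.prod_univ_two]
  simp

section Parity

variable {s} (hs : ∀ g, g % 2 = 1 → s g = 0)

include hs

theorem coeff_logEuler_kernelA_eq_zero [IsAddTorsionFree B] {p q : ℕ} (hpq : (p + q) % 2 = 1) :
    coeff (bidegree p q) (logEuler (kernelA s)) = 0 := by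
  have hsymm : rescale ![-1, -1] (kernelA s) = kernelA s := ext_bidegree fun p q => by
    rw [coeff_bidegree_rescale, ← pow_add, coeff_bidegree_kernelA]
    split_ifs with h h'
    · simp [h]
    · rw [mul_zero]
    · rcases Nat.even_or_odd (p + q) with hpq | hpq
      · rw [hpq.neg_one_pow, one_mul]
      · rw [hs _ (by have := Nat.odd_iff.1 hpq; omega), mul_zero]
  have h := congrArg (coeff (bidegree p q)) (rescale_logEuler ![-1, -1] (constantCoeff_kernelA s))
  rw [hsymm, coeff_bidegree_rescale, ← pow_add, (Nat.odd_iff.2 hpq).neg_one_pow, neg_one_mul] at h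
  exact self_eq_neg.1 h.symm

theorem add_mul_rescale_kernelA : (X 1 + X 0) * rescale ![1, -1] (kernelA s) =
    (X 1 + X 0) - X 0 * (X 1 * (axisSeries 0 s + axisSeries 1 s)) := by
  have h0 : rescale ![1, -1] (axisSeries 0 s) = axisSeries 0 s := ext_bidegree fun p q => by
    rw [coeff_bidegree_rescale, coeff_bidegree_axisSeries_zero]
    split_ifs with h <;> simp [h]
  have h1 : rescale ![1, -1] (axisSeries 1 s) = -axisSeries 1 s := ext_bidegree fun p q => by
    rw [coeff_bidegree_rescale, map_neg, coeff_bidegree_axisSeries_one]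
    split_ifs with h
    · rcases Nat.even_or_odd q with hq | hq
      · rw [hs _ (by have := Nat.even_iff.1 hq; omega), mul_zero, neg_zero]
      · rw [hq.neg_one_pow, one_pow, one_mul, neg_one_mul]
    · rw [mul_zero, neg_zero]
  have h := congrArg (rescale ![1, -1]) (sub_mul_kernelA s)
  simp only [map_mul, map_sub, rescale_X, h0, h1, Matrix.cons_val_zero, Matrix.cons_val_one,
    map_one, map_neg, one_mul, neg_one_mul] at h
  linear_combination -h

end Parity

end Kernel

/-! ### The dispersionless BKP hierarchy through second derivatives -/

section DispersionlessBKP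

open MvPowerSeries Finset

theorem one_sub_div_inv_sub_inv {K : Type*} [Field K] {a b c u : K} (ha : a ≠ 0) (hb : b ≠ 0)
    (hab : b - a ≠ 0) (h : (b - a) * c = (b - a) - a * (b * u)) :
    1 - u / (a⁻¹ - b⁻¹) = c := by
  rw [inv_sub_inv ha hb]
  field_simp
  linear_combination -h

theorem one_sub_div_inv_add_inv {K : Type*} [Field K] {a b c u : K} (ha : a ≠ 0) (hb : b ≠ 0)
    (hab : b + a ≠ 0) (h : (b + a) * c = (b + a) - a * (b * u)) :
    1 - u / (a⁻¹ + b⁻¹) = c := by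
  rw [inv_add_inv ha hb, add_comm a]
  field_simp
  linear_combination -h

theorem one_sub_axisSeries_div_mul_eq_iff {B K : Type*} [CommRing B] [Nontrivial B] [Field K]
    {φ : MvPowerSeries (Fin 2) B →+* K} (hφ : Function.Injective φ) {s : ℕ → B}
    (hs : ∀ g, g % 2 = 1 → s g = 0) (E : MvPowerSeries (Fin 2) B) :
    (1 - φ (axisSeries 0 s + axisSeries 1 s) / ((φ (X 0))⁻¹ + (φ (X 1))⁻¹)) * φ E =
        1 - φ (axisSeries 0 s - axisSeries 1 s) / ((φ (X 0))⁻¹ - (φ (X 1))⁻¹) ↔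
      rescale ![1, -1] (kernelA s) * E = kernelA s := by
  have hne {F : MvPowerSeries (Fin 2) B} (d : Fin 2 →₀ ℕ) (hd : coeff d F = 1) : φ F ≠ 0 :=
    (map_ne_zero_iff φ hφ).2 fun h => by simp [h] at hd
  have hX (i : Fin 2) : φ (X i) ≠ 0 := hne (Finsupp.single i 1) (by simp [coeff_X])
  have hsub : φ (X 1) - φ (X 0) ≠ 0 := by
    rw [← map_sub]
    exact hne (Finsupp.single 1 1) (by simp [coeff_X, Finsupp.single_left_inj])
  have hadd : φ (X 1) + φ (X 0) ≠ 0 := by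
    rw [← map_add]
    exact hne (Finsupp.single 1 1) (by simp [coeff_X, Finsupp.single_left_inj])
  have hA := congrArg φ (sub_mul_kernelA s)
  have hA' := congrArg φ (add_mul_rescale_kernelA hs)
  simp only [map_mul, map_sub, map_add] at hA hA' ⊢
  rw [one_sub_div_inv_sub_inv (hX 0) (hX 1) hsub hA, one_sub_div_inv_add_inv (hX 0) (hX 1) hadd hA',
    ← map_mul, hφ.eq_iff]

theorem coeff_two_mul_DB (i : Fin 2) {G : ZSeries} (hG : ∀ d, d i ≠ 0 → coeff d G = 0)
    (d : Fin 2 →₀ ℕ) : coeff d (2 * DB i G) = if d i % 2 = 1 then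
      (2 / (2 * ((d i / 2 : ℕ) : ℂ) + 1)) • dOdd (d i / 2) (coeff (d - Finsupp.single i (d i)) G)
    else 0 := by
  let term (n : ℕ) : TSeries := if 2 * n + 1 ≤ d i then
    (1 / (2 * (n : ℂ) + 1)) • dOdd n (coeff (d - Finsupp.single i (2 * n + 1)) G) else 0
  have hDB : coeff d (DB i G) = ∑ n ∈ range (d i), term n := rfl
  have hzero (n : ℕ) (hn : 2 * n + 1 ≠ d i) : term n = 0 := by
    dsimp only [term]
    split_ifs with h
    · rw [hG _ (by rw [Finsupp.tsub_apply, Finsupp.single_eq_same]; omega), dOdd, map_zero,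
        smul_zero]
    · rfl
  rw [two_mul, map_add, ← two_smul ℂ (coeff d (DB i G)), hDB]
  split_ifs with hd
  · rw [Finset.sum_eq_single (d i / 2) (fun n _ hn => hzero n (by omega))
      (fun h => absurd (mem_range.2 (by omega)) h)]
    dsimp only [term]
    rw [if_pos (by omega), smul_smul, mul_one_div,
      show 2 * (d i / 2) + 1 = d i by omega]
  · rw [Finset.sum_eq_zero fun n _ => hzero n (by omega), smul_zero]

instance : IsAddTorsionFree TSeries := IsAddTorsionFree.of_module_rat TSeries

theorem coeff_C_eq_zero {i : Fin 2} (F₀ : TSeries) (d : Fin 2 →₀ ℕ) (hd : d i ≠ 0) :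
    coeff d (C F₀ : ZSeries) = 0 := by
  rw [coeff_C, if_neg fun h => hd (by rw [h, Finsupp.zero_apply])]

variable (F₀ : TSeries)

/-- The second derivative of `f = changeOfVariables F₀` with respect to `t_{n+1}` and `t_{m+1}`,
before the rescaling of the times. -/
def hessian (n m : ℕ) : TSeries :=
  (2 / ((2 * (n : ℂ) + 1) * (2 * m + 1))) • dOdd n (dOdd m F₀)

/-- The values of the coordinates `s_g = t_{N-g}` of the `A` type manifold at which the `B`
hierarchy evaluates its potential: the second derivatives `∂_1 ∂_{g/2+1} f` for even `g`, and zero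
for odd `g`. -/
def oddCoord (g : ℕ) : TSeries := if g % 2 = 0 then hessian F₀ 0 (g / 2) else 0

theorem dOdd_zero_smul_dOdd (m : ℕ) :
    dOdd 0 ((2 / (2 * (m : ℂ) + 1)) • dOdd m F₀) = hessian F₀ 0 m := by
  rw [hessian, Nat.cast_zero, mul_zero, zero_add, one_mul]
  exact Derivation.map_smul _ _ _

theorem dFirst_two_mul_DB_C (i : Fin 2) :
    dFirst (2 * DB i (C F₀)) = axisSeries i (oddCoord F₀) := by
  ext1 d
  change dOdd 0 (coeff d _) = _
  have hd : d - Finsupp.single i (d i) = 0 ↔ d = Finsupp.single i (d i) := by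
    rw [tsub_eq_zero_iff_le]
    exact ⟨fun h => h.antisymm (Finsupp.single_le_iff.2 le_rfl), Eq.le⟩
  rw [coeff_two_mul_DB i (coeff_C_eq_zero F₀), coeff_C, coeff_axisSeries, oddCoord]
  by_cases hodd : d i % 2 = 1
  · rw [if_pos hodd, if_pos (show (d i - 1) % 2 = 0 by omega)]
    by_cases haxis : d = Finsupp.single i (d i)
    · rw [if_pos (hd.2 haxis), if_pos ⟨by omega, haxis⟩, dOdd_zero_smul_dOdd,
        show (d i - 1) / 2 = d i / 2 by omega]
    · rw [if_neg (mt hd.1 haxis), if_neg fun h => haxis h.2]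
      simp only [dOdd, map_zero, smul_zero]
  · rw [if_neg hodd, dOdd, map_zero, eq_comm, ite_eq_right_iff]
    exact fun h => if_neg (by omega)

theorem dFirst_add (G H : ZSeries) : dFirst (G + H) = dFirst G + dFirst H :=
  MvPowerSeries.ext fun _ => map_add (pderiv ℂ 0) _ _

theorem dFirst_sub (G H : ZSeries) : dFirst (G - H) = dFirst G - dFirst H :=
  MvPowerSeries.ext fun _ => map_sub (pderiv ℂ 0) _ _

theorem coeff_two_mul_DB_DB_C (p q : ℕ) :
    coeff (bidegree p q) (2 * DB 0 (2 * DB 1 (C F₀))) =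
      if p % 2 = 1 ∧ q % 2 = 1 then 2 * hessian F₀ (p / 2) (q / 2) else 0 := by
  have hC (d : Fin 2 →₀ ℕ) (hd : d 0 ≠ 0) : coeff d (2 * DB 1 (C F₀)) = 0 := by
    rw [coeff_two_mul_DB 1 (coeff_C_eq_zero F₀), coeff_C_eq_zero (i := 0)]
    · simp [dOdd]
    · simpa using hd
  rw [coeff_two_mul_DB 0 hC, coeff_two_mul_DB 1 (coeff_C_eq_zero F₀)]
  simp only [bidegree_apply_zero, bidegree_apply_one, bidegree_sub_single_zero,
    bidegree_sub_single_one, Nat.sub_self]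
  by_cases hp : p % 2 = 1
  · by_cases hq : q % 2 = 1
    · rw [if_pos hp, if_pos hq, if_pos ⟨hp, hq⟩, hessian]
      have hC₀ : coeff (bidegree 0 0) (C F₀ : ZSeries) = F₀ := by simp [bidegree]
      rw [hC₀, two_mul (_ • _ : TSeries), ← two_smul ℂ, smul_smul]
      simp only [dOdd, Derivation.map_smul, smul_smul, div_mul_div_comm, mul_div_assoc]
    · rw [if_pos hp, if_neg hq, if_neg fun h => hq h.2, dOdd, map_zero, smul_zero]
  · rw [if_neg hp, if_neg fun h => hp h.1]

theorem solvesDispersionlessBKP_iff_eulerSeries : SolvesDispersionlessBKP F₀ ↔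
    eulerSeries (2 * DB 0 (2 * DB 1 (C F₀))) = logEuler (kernelA (oddCoord F₀)) -
      rescale ![1, -1] (logEuler (kernelA (oddCoord F₀))) := by
  have hs (g : ℕ) (hg : g % 2 = 1) : oddCoord F₀ g = 0 := if_neg (by omega)
  have hF : constantCoeff (2 * DB 0 (2 * DB 1 (C F₀))) = 0 := by
    simpa [bidegree] using coeff_two_mul_DB_DB_C F₀ 0 0
  have hA := constantCoeff_kernelA (oddCoord F₀)
  rw [rescale_logEuler _ hA,
    ← mul_exp_subst_eq_iff (R := ℂ) (by rw [constantCoeff_rescale, hA]) hA hF,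
    ← one_sub_axisSeries_div_mul_eq_iff (IsFractionRing.injective ZSeries ZField) hs,
    ← dFirst_two_mul_DB_C, ← dFirst_two_mul_DB_C, ← dFirst_add, ← dFirst_sub]
  rfl

theorem solvesDispersionlessBKP_iff : SolvesDispersionlessBKP F₀ ↔
    ∀ n m : ℕ, ((2 * (n + m + 1) : ℕ) : ℂ) • hessian F₀ n m =
      coeff (bidegree (2 * n + 1) (2 * m + 1)) (logEuler (kernelA (oddCoord F₀))) := by
  have hs (g : ℕ) (hg : g % 2 = 1) : oddCoord F₀ g = 0 := if_neg (by omega)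
  set L := logEuler (kernelA (oddCoord F₀))
  have hcoeff (p q : ℕ) : coeff (bidegree p q) (L - rescale ![1, -1] L) =
      (1 - (-1) ^ q) * coeff (bidegree p q) L := by
    rw [map_sub, coeff_bidegree_rescale, one_pow, one_mul, sub_mul, one_mul]
  rw [solvesDispersionlessBKP_iff_eulerSeries]
  constructor
  · intro h n m
    have hnm := congrArg (coeff (bidegree (2 * n + 1) (2 * m + 1))) h
    rw [coeff_eulerSeries, degree_bidegree, coeff_two_mul_DB_DB_C, if_pos (by omega), hcoeff,
      Odd.neg_one_pow ⟨m, rfl⟩, show (2 * n + 1) / 2 = n by omega,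
      show (2 * m + 1) / 2 = m by omega] at hnm
    refine nsmul_right_injective two_ne_zero ?_
    rw [Nat.cast_smul_eq_nsmul]
    simp only [nsmul_eq_mul]
    push_cast at hnm ⊢
    linear_combination hnm
  · refine fun h => ext_bidegree fun p q => ?_
    rw [coeff_eulerSeries, degree_bidegree, coeff_two_mul_DB_DB_C, hcoeff]
    rcases Nat.mod_two_eq_zero_or_one q with hq | hq
    · rw [if_neg (by omega), (Nat.even_iff.2 hq).neg_one_pow, mul_zero, sub_self, zero_mul]
    rcases Nat.mod_two_eq_zero_or_one p with hp | hp
    · rw [if_neg (by omega), coeff_logEuler_kernelA_eq_zero hs (by omega), mul_zero, mul_zero]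
    have hpq := h (p / 2) (q / 2)
    rw [show 2 * (p / 2) + 1 = p by omega, show 2 * (q / 2) + 1 = q by omega,
      show 2 * (p / 2 + q / 2 + 1) = p + q by omega, Nat.cast_smul_eq_nsmul, nsmul_eq_mul] at hpq
    rw [if_pos ⟨hp, hq⟩, (Nat.odd_iff.2 hq).neg_one_pow]
    linear_combination 2 * hpq

end DispersionlessBKP

/-! ### The hierarchy of type `B` through second derivatives -/

section ChangeOfVariables

open MvPowerSeries

variable (F₀ : TSeries)

theorem dT_dT_changeOfVariables (n m : ℕ) :
    dT (n + 1) (dT (m + 1) (changeOfVariables F₀)) =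
      rescale (fun n : ℕ => 1 / (2 * (n : ℂ) + 1)) (hessian F₀ n m) := by
  rw [dT, dT, changeOfVariables, two_mul, ← two_smul ℂ, Nat.add_sub_cancel, Nat.add_sub_cancel,
    Derivation.map_smul, pderiv_rescale, smul_smul, Derivation.map_smul, pderiv_rescale,
    smul_smul, hessian, rescale_smul, mul_one_div, mul_one_div, div_div,
    mul_comm (2 * (m : ℂ) + 1)]
  rfl

theorem solvesBHierarchy_changeOfVariables_iff : SolvesBHierarchy (changeOfVariables F₀) ↔
    ∀ n m : ℕ, hessian F₀ n m = ∑ γ : Composition (n + 1 + (m + 1) - 1),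
      RB (n + 1) (m + 1) γ.blocks • (γ.blocks.map fun g => hessian F₀ 0 (g - 1)).prod := by
  have hne (n : ℕ) : 1 / (2 * (n : ℂ) + 1) ≠ 0 :=
    one_div_ne_zero (by exact_mod_cast Nat.succ_ne_zero (2 * n))
  have hprod {k : ℕ} (γ : Composition k) :
      (γ.blocks.map fun g => dT 1 (dT g (changeOfVariables F₀))).prod =
        rescale (fun n : ℕ => 1 / (2 * (n : ℂ) + 1))
          (γ.blocks.map fun g => hessian F₀ 0 (g - 1)).prod := by
    rw [map_list_prod, List.map_map]
    refine congrArg List.prod (List.map_congr_left fun g hg => ?_)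
    rw [Function.comp_apply, ← dT_dT_changeOfVariables, Nat.sub_add_cancel (γ.blocks_pos hg)]
  have hiff (n m : ℕ) := (rescale_injective hne).eq_iff (a := hessian F₀ n m)
    (b := ∑ γ : Composition (n + 1 + (m + 1) - 1),
      RB (n + 1) (m + 1) γ.blocks • (γ.blocks.map fun g => hessian F₀ 0 (g - 1)).prod)
  simp only [map_sum, rescale_smul, ← hprod, ← dT_dT_changeOfVariables] at hiff
  simp only [← hiff]
  refine ⟨fun h n m => h _ _ n.succ_pos m.succ_pos, fun h α β hα hβ => ?_⟩
  obtain ⟨n, rfl⟩ := Nat.exists_eq_add_of_le' hα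
  obtain ⟨m, rfl⟩ := Nat.exists_eq_add_of_le' hβ
  exact h n m

theorem smul_sum_RB_hessian (n m : ℕ) : ((2 * (n + m + 1) : ℕ) : ℂ) •
    ∑ γ : Composition (n + 1 + (m + 1) - 1),
      RB (n + 1) (m + 1) γ.blocks • (γ.blocks.map fun g => hessian F₀ 0 (g - 1)).prod =
    coeff (bidegree (2 * n + 1) (2 * m + 1)) (logEuler (kernelA (oddCoord F₀))) :=
  smul_sum_RB (U := fun g => hessian F₀ 0 (g - 1)) n m
    (secondDerivRecursion_logEuler_kernelA (oddCoord F₀) _)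

end ChangeOfVariables

end Frob

end

theorem mainTheorem3 (F₀ : Frob.TSeries) :
    Frob.SolvesBHierarchy (Frob.changeOfVariables F₀) ↔ Frob.SolvesDispersionlessBKP F₀ := by
  rw [Frob.solvesBHierarchy_changeOfVariables_iff, Frob.solvesDispersionlessBKP_iff]
  refine forall_congr' fun n => forall_congr' fun m => ?_
  have hdegree : ((2 * (n + m + 1) : ℕ) : ℂ) ≠ 0 := Nat.cast_ne_zero.2 (by omega)
  rw [← Frob.smul_sum_RB_hessian]
  exact (smul_right_injective Frob.TSeries hdegree).eq_iff.symm
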